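/- Let $c>0$ and $\lambda>0$. Throughout, "Brownian motion" means a process $B(t)$, $t\ge 0$, equal to $\sqrt2$ times a standard Brownian motion, so that $\mathbb{E}e^{i\xi B(t)}=e^{-t\xi^2}$ and $|B(t)|$ has density $e^{-x^2/(4t)}/\sqrt{\pi t}$, $x>0$. Let $B$ be a Brownian motion and let $H^{1/2}$ be a stable subordinator of order $1/2$, independent of $B$, normalized by $\mathbb{E}e^{-\mu H^{1/2}(t)}=e^{-t\sqrt\mu}$ for $\mu>0$. Put $$\mathcal{L}^{1/2}(t)=\inf\{s\ge 0:\ s+(2\lambda)^2H^{1/2}(s)\ge t\},\qquad W_1(t)=B\big(c^2\mathcal{L}^{1/2}(t)\big).$$ Let $T(t)=V\int_0^t(-1)^{N(s)}\,ds$ be the telegraph process with parameters $c,\lambda$, where $N$ is a homogeneous Poisson process with rate $\lambda$ and $V$ is independent of $N$ with $\Pr\{V=c\}=\Pr\{V=-c\}=\tfrac12$. Let $|B'|$ be the absolute value of a Brownian motion $B'$, independent of $T$, and put $\mathcal{W}(t)=T(|B'(t)|)$. Then: 1. For each $t>0$, $W_1(t)$ and $\mathcal{W}(t)$ have the same distribution: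 $$B\big(c^2\mathcal{L}^{1/2}(t)\big)\ \stackrel{\mathrm{law}}{=}\ T\big(|B'(t)|\big).$$ 2. For all $t\ge0$ and $\xi\in\mathbb{R}$, with $D\in\mathbb{C}$ a square root of $\lambda^2-c^2\xi^2$, $$\mathbb{E}e^{i\xi T(t)}=\frac12\left[\Big(1+\frac{\lambda}{D}\Big)e^{-\lambda t+tD}+\Big(1-\frac{\lambda}{D}\Big)e^{-\lambda t-tD}\right]$$ if $D\ne0$, and $\mathbb{E}e^{i\xi T(t)}=e^{-\lambda t}(1+\lambda t)$ (the limit of this expression) if $D=0$. 3. For all $\xi\in\mathbb{R}$ and $\mu>0$, both families of laws have the same Fourier–Laplace transform $$\int_0^\infty e^{-\mu t}\,\mathbb{E}e^{i\xi W_1(t)}\,dt=\int_0^\infty e^{-\mu t}\,\mathbb{E}e^{i\xi \mathcal{W}(t)}\,dt=\frac{1+2\lambda\mu^{-1/2}}{\mu+2\lambda\sqrt\mu+c^2\xi^2}.$$ -/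

import Mathlib

open MeasureTheory ProbabilityTheory
open scoped NNReal ENNReal

/-- `B` is a Brownian motion run at speed `2`, that is `√2` times a standard Brownian motion:
its generator is `d²/dx²` and `B t` is centred Gaussian with variance `2 t`, so that
`𝔼 exp (i ξ B t) = exp (-t ξ²)` and `|B t|` has density `exp (-x² / (4 t)) / √(π t)` on `(0, ∞)`. -/
structure IsBrownianSpeedTwo {Ω : Type*} [MeasurableSpace Ω] (B : ℝ≥0 → Ω → ℝ)
    (P : Measure Ω) : Prop where
  measurable : ∀ t, Measurable (B t)
  isBrownianReal : IsBrownianReal (fun t ω ↦ (√2)⁻¹ * B t ω) P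

/-- `H` is a totally positively skewed stable process (stable subordinator) of order `ν`,
normalized by `𝔼 exp (-μ H t) = exp (-t μ ^ ν)`. -/
structure IsStableSubordinator {Ω : Type*} [MeasurableSpace Ω] (ν : ℝ) (H : ℝ≥0 → Ω → ℝ)
    (P : Measure Ω) : Prop where
  measurable : ∀ t, Measurable (H t)
  zero : ∀ᵐ ω ∂P, H 0 ω = 0
  indep_increments : HasIndepIncrements H P
  stationary_increments :
    ∀ s t : ℝ≥0, IdentDistrib (fun ω ↦ H (s + t) ω - H s ω) (H t) P P
  monotone : ∀ᵐ ω ∂P, Monotone (fun t ↦ H t ω)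
  right_continuous :
    ∀ᵐ ω ∂P, ∀ t, ContinuousWithinAt (fun s ↦ H s ω) (Set.Ici t) t
  laplace : ∀ t : ℝ≥0, ∀ μ : ℝ, 0 < μ →
    ∫ ω, Real.exp (-μ * H t ω) ∂P = Real.exp (-(t : ℝ) * μ ^ ν)

/-- `N` is a homogeneous Poisson process with rate `r`. -/
structure IsPoissonProcess {Ω : Type*} [MeasurableSpace Ω] (r : ℝ≥0) (N : ℝ≥0 → Ω → ℕ)
    (P : Measure Ω) : Prop where
  measurable : ∀ t, Measurable (N t)
  zero : ∀ᵐ ω ∂P, N 0 ω = 0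
  indep_increments : HasIndepIncrements (fun t ω ↦ (N t ω : ℤ)) P
  law_increments :
    ∀ s t : ℝ≥0, HasLaw (fun ω ↦ N (s + t) ω - N s ω) (poissonMeasure (r * t)) P
  monotone : ∀ᵐ ω ∂P, Monotone (fun t ↦ N t ω)
  right_continuous :
    ∀ᵐ ω ∂P, ∀ t, ContinuousWithinAt (fun s ↦ N s ω) (Set.Ici t) t

noncomputable section

/-- The process `s + (2 lam)² H s`. -/
def driftedProcess {Ω : Type*} (lam : ℝ≥0) (H : ℝ≥0 → Ω → ℝ) (s : ℝ≥0) (ω : Ω) : ℝ :=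
  s + (2 * lam) ^ 2 * H s ω

/-- The inverse `inf {s : s + (2 lam)² H s ≥ t}` of the process `s + (2 lam)² H s`. -/
def inverseProcess {Ω : Type*} (lam : ℝ≥0) (H : ℝ≥0 → Ω → ℝ) (t : ℝ≥0) (ω : Ω) : ℝ≥0 :=
  sInf {s : ℝ≥0 | (t : ℝ) ≤ driftedProcess lam H s ω}

/-- The motion `V ∫₀ᵗ (-1)^(N s) ds` with initial velocity `V`, reversed at the jumps of `N`. -/
def telegraphMotion {Ω : Type*} (V : Ω → ℝ) (N : ℝ≥0 → Ω → ℕ) (t : ℝ≥0) (ω : Ω) : ℝ :=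
  V ω * ∫ s in (0 : ℝ)..t, (-1 : ℝ) ^ N s.toNNReal ω

/-- `T` is the telegraph process with parameters `c` and `lam`: `T t = V ∫₀ᵗ (-1)^(N s) ds`, where
`N` is a Poisson process with rate `lam` and `V` is independent of `N`, uniform on `{c, -c}`. -/
def IsTelegraphProcess {Ω : Type*} [MeasurableSpace Ω] (c lam : ℝ≥0) (T : ℝ≥0 → Ω → ℝ)
    (P : Measure Ω) : Prop :=
  ∃ (V : Ω → ℝ) (N : ℝ≥0 → Ω → ℕ),
    HasLaw V ((2⁻¹ : ℝ≥0∞) • Measure.dirac (c : ℝ) + (2⁻¹ : ℝ≥0∞) • Measure.dirac (-(c : ℝ))) P ∧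
    IsPoissonProcess lam N P ∧
    IndepFun V (fun ω t ↦ N t ω) P ∧
    T = telegraphMotion V N

/-- The Fourier transform `𝔼 exp (i ξ X)` of the law of `X`. -/
def fourierLaw {Ω : Type*} [MeasurableSpace Ω] (X : Ω → ℝ) (P : Measure Ω) (ξ : ℝ) : ℂ :=
  ∫ ω, Complex.exp (Complex.I * ξ * X ω) ∂P

/-- The Fourier–Laplace transform `∫₀^∞ exp (-μ t) 𝔼 exp (i ξ X t) dt` of the family of laws of
the process `X`. -/
def fourierLaplace {Ω : Type*} [MeasurableSpace Ω] (X : ℝ≥0 → Ω → ℝ) (P : Measure Ω)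
    (ξ μ : ℝ) : ℂ :=
  ∫ t in Set.Ioi (0 : ℝ), Complex.exp (-μ * t) * fourierLaw (X t.toNNReal) P ξ

end

/-! Both sides are a process run at an independent random time, and the two families of laws have
the same Fourier–Laplace transform. For fixed `ξ` both Fourier transforms are bounded and continuous
in `t`, so equal Laplace transforms force equality at every `t` (`eq_of_laplace_eq`), and
characteristic functions determine laws.

Brownian side: conditioning on the inverse `L` of `d s = s + (2 lam)² H s` gives `𝔼 exp (-c² ξ² L
t)`. Since `d s < t` and `s < L t` agree except at `s = L t`, Fubini expresses the Laplace transform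
of `exp (-a L t)` through `exp (-μ d s)` path by path (`HasUnitDrift.laplace_firstPassage`). The
mean of the latter is `exp (-s (μ + 2 lam √μ))`, the square root coming from order `1/2`.

Telegraph side: the parity of `N t - N s` is independent of the path up to `s` and has mean `exp (-2
lam (t - s))`. Hence the Fourier transform of the position and its velocity-weighted version solve a
linear system (`exists_hasDerivAt_positionChar`). Averaging over the sign of `V` gives `f'' + 2 lam
f' + c² ξ² f = 0`, `f 0 = 1`, `f' 0 = 0`, which yields the explicit formula and the Laplace
transform `(p + 2 lam) / (p² + 2 lam p + c² ξ²)`. Brownian motion weighted by `exp (-μ t) dt` has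
density `exp (-√μ |x|) / (2 √μ)`, so time `|B' t|` replaces `p` by `√μ` and adds a factor `1 / √μ`
(`laplace_integral_abs`). This is the transform of the Brownian side. -/

section Auxiliary

open Filter
open scoped Topology

/-! ### Processes evaluated at random times -/

section RandomTime

variable {Ω : Type*} [MeasurableSpace Ω] {P : Measure Ω}

/-- The smallest multiple of `1 / (n + 1)` which is strictly larger than `x`. -/
noncomputable def gridAbove (n : ℕ) (x : ℝ≥0) : ℝ≥0 :=
  ((⌊(n + 1 : ℝ≥0) * x⌋₊ + 1 : ℕ) : ℝ≥0) / (n + 1)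

lemma le_gridAbove (n : ℕ) (x : ℝ≥0) : x ≤ gridAbove n x := by
  rw [gridAbove, le_div_iff₀ (by positivity), mul_comm]
  push_cast
  exact (Nat.lt_floor_add_one _).le

lemma gridAbove_le (n : ℕ) (x : ℝ≥0) : gridAbove n x ≤ x + 1 / (n + 1) := by
  rw [gridAbove, div_le_iff₀ (by positivity), add_mul x, one_div,
    inv_mul_cancel₀ (by positivity), mul_comm x]
  push_cast
  gcongr
  exact Nat.floor_le (by positivity)

lemma tendsto_gridAbove (x : ℝ≥0) :
    Tendsto (fun n ↦ gridAbove n x) atTop (𝓝[≥] x) := by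
  refine tendsto_nhdsWithin_iff.2 ⟨?_, Eventually.of_forall fun n ↦ le_gridAbove n x⟩
  refine tendsto_of_tendsto_of_tendsto_of_le_of_le tendsto_const_nhds ?_
    (fun n ↦ le_gridAbove n x) (fun n ↦ gridAbove_le n x)
  have : Tendsto (fun n : ℕ ↦ x + 1 / ((n : ℝ≥0) + 1)) atTop (𝓝 (x + 0)) :=
    tendsto_const_nhds.add tendsto_one_div_add_atTop_nhds_zero_nat
  simpa using this

lemma tendsto_comp_gridAbove {E : Type*} [TopologicalSpace E] {f : ℝ≥0 → E} {x : ℝ≥0}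
    (hf : ContinuousWithinAt f (Set.Ici x) x) :
    Tendsto (fun n ↦ f (gridAbove n x)) atTop (𝓝 (f x)) :=
  hf.tendsto.comp (tendsto_gridAbove x)

lemma aemeasurable_countable_randomTime {E : Type*} [MeasurableSpace E] {Z : ℕ → Ω → E}
    (hZ : ∀ k, AEMeasurable (Z k) P) {K : Ω → ℕ} (hK : AEMeasurable K P) :
    AEMeasurable (fun ω ↦ Z (K ω) ω) P := by
  have h : Measurable (fun p : ℕ × Ω ↦ (hZ p.1).mk (Z p.1) p.2) :=
    measurable_from_prod_countable_right fun k ↦ (hZ k).measurable_mk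
  refine ⟨fun ω ↦ (hZ (hK.mk K ω)).mk _ ω,
    h.comp (hK.measurable_mk.prodMk measurable_id), ?_⟩
  filter_upwards [hK.ae_eq_mk, ae_all_iff.2 fun k ↦ (hZ k).ae_eq_mk] with ω h1 h2
  rw [h2, h1]

lemma aemeasurable_gridIndex (n : ℕ) {X : Ω → ℝ≥0} (hX : AEMeasurable X P) :
    AEMeasurable (fun ω ↦ ⌊(n + 1 : ℝ≥0) * X ω⌋₊) P :=
  Nat.measurable_floor.comp_aemeasurable (hX.const_mul _)

/-- A process with right-continuous paths evaluated at a random time is a random variable. -/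
lemma aemeasurable_randomTime {E : Type*} [TopologicalSpace E]
    [TopologicalSpace.PseudoMetrizableSpace E] [MeasurableSpace E] [BorelSpace E]
    {Y : ℝ≥0 → Ω → E} (hY : ∀ s, AEMeasurable (Y s) P)
    (hc : ∀ᵐ ω ∂P, ∀ s, ContinuousWithinAt (fun u ↦ Y u ω) (Set.Ici s) s)
    {X : Ω → ℝ≥0} (hX : AEMeasurable X P) :
    AEMeasurable (fun ω ↦ Y (X ω) ω) P := by
  -- The grid times take countably many values and decrease to within `1 / (n + 1)` of `X` from the
  -- right, where the paths are continuous.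
  refine aemeasurable_of_tendsto_metrizable_ae (f := fun n ω ↦ Y (gridAbove n (X ω)) ω)
    atTop (fun n ↦ ?_) ?_
  · exact aemeasurable_countable_randomTime
      (Z := fun k ↦ Y (((k + 1 : ℕ) : ℝ≥0) / (n + 1))) (fun k ↦ hY _) (aemeasurable_gridIndex n hX)
  · filter_upwards [hc] with ω hω using tendsto_comp_gridAbove (hω _)

/-- A process with right-continuous paths is jointly measurable. -/
lemma aemeasurable_uncurry_toNNReal {E : Type*} [TopologicalSpace E]
    [TopologicalSpace.PseudoMetrizableSpace E] [MeasurableSpace E] [BorelSpace E]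
    {Y : ℝ≥0 → Ω → E} (hY : ∀ s, AEMeasurable (Y s) P)
    (hc : ∀ᵐ ω ∂P, ∀ s, ContinuousWithinAt (fun u ↦ Y u ω) (Set.Ici s) s)
    [SFinite P] (ν : Measure ℝ) :
    AEMeasurable (fun p : ℝ × Ω ↦ Y p.1.toNNReal p.2) (ν.prod P) :=
  -- On the product space the time coordinate is itself a random time.
  aemeasurable_randomTime (P := ν.prod P) (Y := fun s p ↦ Y s p.2)
    (X := fun p : ℝ × Ω ↦ p.1.toNNReal) (fun s ↦ (hY s).comp_snd)
    (Measure.quasiMeasurePreserving_snd.ae hc)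
    (measurable_real_toNNReal.comp measurable_fst).aemeasurable

/-- Split according to the value of `K`: on each piece only one `Z k` occurs, so independence of
that single variable from `K` is enough. The indicators sum to `1`, which dominates the series. -/
lemma integral_countable_randomTime [IsProbabilityMeasure P] {Z : ℕ → Ω → ℂ}
    (hZ : ∀ k, AEMeasurable (Z k) P) (hb : ∀ k ω, ‖Z k ω‖ ≤ 1) {K : Ω → ℕ}
    (hK : AEMeasurable K P) (hind : ∀ k, IndepFun (Z k) K P) :
    ∫ ω, Z (K ω) ω ∂P = ∫ ω, (∫ ω', Z (K ω) ω' ∂P) ∂P := by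
  have hterm : ∀ k, ∫ ω, Set.indicator {k} (fun _ ↦ (1 : ℂ)) (K ω) * Z k ω ∂P
      = ∫ ω, Set.indicator {k} (fun _ ↦ (1 : ℂ)) (K ω) * ∫ ω', Z k ω' ∂P ∂P := by
    intro k
    have h := (hind k).symm.comp (φ := Set.indicator {k} (fun _ ↦ (1 : ℂ))) (ψ := id)
      (measurable_of_countable _) measurable_id
    have hmeas : AEStronglyMeasurable (Set.indicator {k} (fun _ ↦ (1 : ℂ)) ∘ K) P :=
      ((measurable_of_countable _).comp_aemeasurable hK).aestronglyMeasurable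
    have := h.integral_mul_eq_mul_integral hmeas (hZ k).aestronglyMeasurable
    rw [integral_mul_const]
    simpa using this
  have hsum : ∀ W : ℕ → Ω → ℂ, (∀ k, AEMeasurable (W k) P) → (∀ k ω, ‖W k ω‖ ≤ 1) →
      ∫ ω, W (K ω) ω ∂P
        = ∑' k, ∫ ω, Set.indicator {k} (fun _ ↦ (1 : ℂ)) (K ω) * W k ω ∂P := by
    intro W hW hWb
    have hpt : ∀ ω, HasSum (fun k ↦ Set.indicator {k} (fun _ ↦ (1 : ℂ)) (K ω) * W k ω)
        (W (K ω) ω) := by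
      intro ω
      convert hasSum_single (f := fun k ↦ Set.indicator {k} (fun _ ↦ (1 : ℂ)) (K ω) * W k ω)
        (K ω) ?_ using 1
      · simp
      · intro k hk
        simp [Set.indicator, hk.symm]
    have hm : ∀ k, AEMeasurable
        (fun ω ↦ Set.indicator {k} (fun _ ↦ (1 : ℂ)) (K ω) * W k ω) P := fun k ↦
      ((measurable_of_countable (Set.indicator {k} fun _ ↦ (1 : ℂ))).comp_aemeasurable hK).mul
        (hW k)
    refine ((hasSum_integral_of_dominated_convergence
      (bound := fun k ω ↦ Set.indicator {k} (fun _ ↦ (1 : ℝ)) (K ω))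
      (fun k ↦ (hm k).aestronglyMeasurable) (fun k ↦ ?_) ?_ ?_ (ae_of_all _ hpt)).tsum_eq).symm
    · refine ae_of_all _ fun ω ↦ ?_
      by_cases h : K ω = k
      · simpa [Set.indicator, h] using hWb k ω
      · simp [Set.indicator, h]
    · refine ae_of_all _ fun ω ↦ ?_
      refine summable_of_ne_finset_zero (s := {K ω}) fun k hk ↦ ?_
      simp only [Finset.mem_singleton] at hk
      simp [Set.indicator, Ne.symm hk]
    · have : (fun ω ↦ ∑' k, Set.indicator {k} (fun _ ↦ (1 : ℝ)) (K ω)) = fun _ ↦ 1 := by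
        funext ω
        rw [tsum_eq_single (K ω)]
        · simp
        · intro k hk
          simp [Set.indicator, hk.symm]
      rw [this]
      exact integrable_const _
  rw [hsum Z hZ hb, hsum (fun k _ ↦ ∫ ω', Z k ω' ∂P) (fun k ↦ aemeasurable_const) ?_]
  · exact tsum_congr hterm
  · intro k _
    simpa using norm_integral_le_of_norm_le_const (μ := P) (ae_of_all _ (hb k))

/-- The expectation of a bounded right-continuous process at a random time `X`, where each
variable of the process is independent of `X`. -/
lemma integral_randomTime [IsProbabilityMeasure P] {Y : ℝ≥0 → Ω → ℂ}
    (hY : ∀ s, AEMeasurable (Y s) P) (hb : ∀ s ω, ‖Y s ω‖ ≤ 1)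
    (hc : ∀ᵐ ω ∂P, ∀ s, ContinuousWithinAt (fun u ↦ Y u ω) (Set.Ici s) s)
    {X : Ω → ℝ≥0} (hX : AEMeasurable X P) (hind : ∀ s, IndepFun (Y s) X P) :
    ∫ ω, Y (X ω) ω ∂P = ∫ ω, (∫ ω', Y (X ω) ω' ∂P) ∂P := by
  have hlim : ∀ s, Tendsto (fun n ↦ ∫ ω', Y (gridAbove n s) ω' ∂P) atTop
      (𝓝 (∫ ω', Y s ω' ∂P)) := by
    intro s
    refine tendsto_integral_of_dominated_convergence (fun _ ↦ 1)
      (fun n ↦ (hY _).aestronglyMeasurable) (integrable_const _)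
      (fun n ↦ ae_of_all _ fun ω ↦ hb _ ω) ?_
    filter_upwards [hc] with ω hω using tendsto_comp_gridAbove (hω s)
  have h1 : Tendsto (fun n ↦ ∫ ω, Y (gridAbove n (X ω)) ω ∂P) atTop
      (𝓝 (∫ ω, Y (X ω) ω ∂P)) := by
    refine tendsto_integral_of_dominated_convergence (fun _ ↦ 1)
      (fun n ↦ ?_) (integrable_const _) (fun n ↦ ae_of_all _ fun ω ↦ hb _ ω) ?_
    · exact (aemeasurable_countable_randomTime
        (Z := fun k ↦ Y (((k + 1 : ℕ) : ℝ≥0) / (n + 1))) (fun k ↦ hY _)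
        (aemeasurable_gridIndex n hX)).aestronglyMeasurable
    · filter_upwards [hc] with ω hω using tendsto_comp_gridAbove (hω _)
  have h2 : Tendsto (fun n ↦ ∫ ω, (∫ ω', Y (gridAbove n (X ω)) ω' ∂P) ∂P) atTop
      (𝓝 (∫ ω, (∫ ω', Y (X ω) ω' ∂P) ∂P)) := by
    refine tendsto_integral_of_dominated_convergence (fun _ ↦ 1)
      (fun n ↦ ?_) (integrable_const _) (fun n ↦ ae_of_all _ fun ω ↦ ?_)
      (ae_of_all _ fun ω ↦ hlim _)
    · exact (aemeasurable_countable_randomTime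
        (Z := fun k _ ↦ ∫ ω', Y (((k + 1 : ℕ) : ℝ≥0) / (n + 1)) ω' ∂P)
        (fun k ↦ aemeasurable_const) (aemeasurable_gridIndex n hX)).aestronglyMeasurable
    · simpa using norm_integral_le_of_norm_le_const (μ := P) (ae_of_all _ (hb _))
  refine tendsto_nhds_unique h1 (h2.congr fun n ↦ ?_)
  refine (integral_countable_randomTime
    (Z := fun k ↦ Y (((k + 1 : ℕ) : ℝ≥0) / (n + 1))) (fun k ↦ hY _) (fun k ω ↦ hb _ ω)
    (aemeasurable_gridIndex n hX) (fun k ↦ ?_)).symm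
  exact (hind _).comp measurable_id (Nat.measurable_floor.comp (measurable_const_mul _))

end RandomTime

/-! ### Uniqueness for Laplace transforms -/

section LaplaceUniqueness

/-- By Weierstrass, `g` is a uniform limit of polynomials, all orthogonal to `g`; hence `∫ g² = 0`,
and continuity gives `g = 0`. -/
lemma eq_zero_of_forall_integral_pow_mul_eq_zero {g : ℝ → ℝ} (hg : ContinuousOn g (Set.Icc 0 1))
    (h : ∀ n : ℕ, ∫ x in (0 : ℝ)..1, x ^ n * g x = 0) : ∀ x ∈ Set.Icc (0 : ℝ) 1, g x = 0 := by
  have huI : Set.uIcc (0 : ℝ) 1 = Set.Icc 0 1 := Set.uIcc_of_le zero_le_one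
  have hpoly : ∀ p : Polynomial ℝ, ∫ x in (0 : ℝ)..1, p.eval x * g x = 0 := by
    intro p
    have : ∀ x, p.eval x * g x = ∑ i ∈ Finset.range (p.natDegree + 1),
        p.coeff i * (x ^ i * g x) := by
      intro x
      rw [Polynomial.eval_eq_sum_range, Finset.sum_mul]
      exact Finset.sum_congr rfl fun i _ ↦ by ring
    simp_rw [this]
    rw [intervalIntegral.integral_finsetSum]
    · simp [h]
    · intro i _
      exact (ContinuousOn.mul continuousOn_const
        ((continuous_pow i).continuousOn.mul (huI ▸ hg))).intervalIntegrable
  obtain ⟨C, hC⟩ := isCompact_Icc.exists_bound_of_continuousOn hg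
  have hC0 : 0 ≤ C := (norm_nonneg _).trans (hC 0 (by simp))
  have hsq : ∫ x in (0 : ℝ)..1, g x * g x = 0 := by
    refine abs_eq_zero.1 (le_antisymm (le_of_forall_pos_le_add fun ε hε ↦ ?_) (abs_nonneg _))
    obtain ⟨p, hp⟩ := exists_polynomial_near_of_continuousOn 0 1 g hg (ε / (C + 1)) (by positivity)
    have hgg : IntervalIntegrable (fun x ↦ g x * g x) volume 0 1 :=
      (huI ▸ hg.mul hg : ContinuousOn _ (Set.uIcc (0 : ℝ) 1)).intervalIntegrable
    have hpg : IntervalIntegrable (fun x ↦ p.eval x * g x) volume 0 1 :=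
      (huI ▸ p.continuous.continuousOn.mul hg :
        ContinuousOn _ (Set.uIcc (0 : ℝ) 1)).intervalIntegrable
    have heq : ∫ x in (0 : ℝ)..1, g x * g x
        = ∫ x in (0 : ℝ)..1, (g x * g x - p.eval x * g x) := by
      rw [intervalIntegral.integral_sub hgg hpg, hpoly, sub_zero]
    rw [heq, zero_add, ← Real.norm_eq_abs]
    refine (intervalIntegral.norm_integral_le_of_norm_le_const (C := ε) fun x hx ↦ ?_).trans
      (by simp)
    rw [Set.uIoc_of_le zero_le_one] at hx
    have hx' : x ∈ Set.Icc (0 : ℝ) 1 := ⟨hx.1.le, hx.2⟩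
    rw [← sub_mul, norm_mul, Real.norm_eq_abs, abs_sub_comm]
    calc |p.eval x - g x| * ‖g x‖ ≤ ε / (C + 1) * C := by
          gcongr
          exacts [(hp x hx').le, hC x hx']
      _ ≤ ε / (C + 1) * (C + 1) := by gcongr; linarith
      _ = ε := by field_simp
  intro x hx
  by_contra hne
  have := intervalIntegral.integral_pos (a := 0) (b := 1) zero_lt_one
    (hg.mul hg) (fun y _ ↦ mul_self_nonneg (g y)) ⟨x, hx, mul_self_pos.2 hne⟩
  exact this.ne' hsq

/-- A bounded continuous real function on `[0, ∞)` whose Laplace transform vanishes is zero. -/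
lemma eq_zero_of_laplace_eq_zero_real {h : ℝ → ℝ} (hc : ContinuousOn h (Set.Ici 0)) {C : ℝ}
    (hb : ∀ t, 0 ≤ t → |h t| ≤ C)
    (hL : ∀ μ : ℝ, 0 < μ → ∫ t in Set.Ioi (0 : ℝ), Real.exp (-μ * t) * h t = 0) :
    ∀ t, 0 ≤ t → h t = 0 := by
  -- The substitution `x = exp (-t)` turns Laplace transforms into moments. The extra factor `x`
  -- makes the function continuous at `0`, where `h` need not have a limit.
  have hg : ContinuousOn (fun x ↦ x * h (-Real.log x)) (Set.Icc 0 1) := by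
    intro x hx
    rcases hx.1.eq_or_lt with rfl | hx0
    · rw [ContinuousWithinAt, zero_mul]
      refine squeeze_zero_norm' (a := fun x ↦ |x| * C) ?_ ?_
      · filter_upwards [self_mem_nhdsWithin] with y hy
        rw [norm_mul, Real.norm_eq_abs, Real.norm_eq_abs]
        gcongr
        exact hb _ (neg_nonneg.2 (Real.log_nonpos hy.1 hy.2))
      · have : Tendsto (fun x : ℝ ↦ |x| * C) (𝓝 0) (𝓝 (|0| * C)) :=
          (continuous_abs.mul continuous_const).tendsto 0
        simp only [abs_zero, zero_mul] at this
        exact this.mono_left nhdsWithin_le_nhds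
    · refine continuousWithinAt_id.mul (ContinuousWithinAt.comp (t := Set.Ici 0)
        (hc _ (neg_nonneg.2 (Real.log_nonpos hx.1 hx.2)))
        (Real.continuousAt_log hx0.ne').neg.continuousWithinAt fun y hy ↦ ?_)
      exact neg_nonneg.2 (Real.log_nonpos hy.1 hy.2)
  have himg : (fun t : ℝ ↦ Real.exp (-t)) '' Set.Ioi 0 = Set.Ioo 0 1 := by
    ext x
    constructor
    · rintro ⟨t, ht, rfl⟩
      exact ⟨Real.exp_pos _, by simpa using ht⟩
    · intro hx
      exact ⟨-Real.log x, neg_pos.2 (Real.log_neg hx.1 hx.2), by simp [Real.exp_log hx.1]⟩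
  have hzero := eq_zero_of_forall_integral_pow_mul_eq_zero hg fun n ↦ by
    rw [intervalIntegral.integral_of_le zero_le_one, integral_Ioc_eq_integral_Ioo, ← himg,
      integral_image_eq_integral_abs_deriv_smul (f' := fun t ↦ -Real.exp (-t)) measurableSet_Ioi]
    -- The exponent is `n` from the monomial, `1` from the extra factor `x` and `1` from the
    -- Jacobian.
    · refine Eq.trans ?_ (hL (n + 2) (by positivity))
      refine setIntegral_congr_fun measurableSet_Ioi fun t _ ↦ ?_
      simp only [abs_neg, abs_of_pos (Real.exp_pos _), Real.log_exp, neg_neg, smul_eq_mul]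
      rw [← Real.exp_nat_mul, ← mul_assoc, ← mul_assoc, ← Real.exp_add, ← Real.exp_add]
      congr 2
      ring
    · intro t _
      simpa using ((hasDerivAt_neg t).exp).hasDerivWithinAt
    · intro a _ b _ hab
      simpa using hab
  intro t ht
  have := hzero (Real.exp (-t)) ⟨(Real.exp_pos _).le, by simpa using ht⟩
  simpa [(Real.exp_pos _).ne'] using this

lemma integrableOn_exp_mul_of_bounded {h : ℝ → ℂ} {C : ℝ}
    (hm : AEStronglyMeasurable h (volume.restrict (Set.Ioi 0)))
    (hb : ∀ t, 0 ≤ t → ‖h t‖ ≤ C) {μ : ℝ} (hμ : 0 < μ) :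
    IntegrableOn (fun t : ℝ ↦ Complex.exp (-μ * t) * h t) (Set.Ioi 0) := by
  have he : IntegrableOn (fun t : ℝ ↦ Real.exp (-μ * t) * C) (Set.Ioi 0) :=
    (integrableOn_exp_mul_Ioi (neg_neg_of_pos hμ) 0).mul_const C
  refine he.mono' ((by fun_prop : Continuous fun t : ℝ ↦
    Complex.exp (-μ * t)).aestronglyMeasurable.mul hm) ?_
  filter_upwards [ae_restrict_mem measurableSet_Ioi] with t ht
  rw [norm_mul, Complex.norm_exp]
  simp only [neg_mul, Complex.neg_re, Complex.mul_re, Complex.ofReal_re, Complex.ofReal_im,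
    mul_zero, sub_zero]
  gcongr
  exact hb t (le_of_lt ht)

/-- Bounded continuous functions on `[0, ∞)` with the same Laplace transform are equal. -/
lemma eq_of_laplace_eq {f g : ℝ → ℂ} (hf : ContinuousOn f (Set.Ici 0))
    (hg : ContinuousOn g (Set.Ici 0)) {C : ℝ} (hfb : ∀ t, 0 ≤ t → ‖f t‖ ≤ C)
    (hgb : ∀ t, 0 ≤ t → ‖g t‖ ≤ C)
    (hL : ∀ μ : ℝ, 0 < μ → ∫ t in Set.Ioi (0 : ℝ), Complex.exp (-μ * t) * f t
      = ∫ t in Set.Ioi (0 : ℝ), Complex.exp (-μ * t) * g t) :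
    ∀ t, 0 ≤ t → f t = g t := by
  have hmeas : ∀ k : ℝ → ℂ, ContinuousOn k (Set.Ici 0) →
      AEStronglyMeasurable k (volume.restrict (Set.Ioi 0)) := fun k hk ↦
    (hk.mono Set.Ioi_subset_Ici_self).aestronglyMeasurable measurableSet_Ioi
  have hd : ∀ t, 0 ≤ t → ‖(f - g) t‖ ≤ C + C := fun t ht ↦
    (norm_sub_le _ _).trans (add_le_add (hfb t ht) (hgb t ht))
  have hint : ∀ μ : ℝ, 0 < μ → ∫ t in Set.Ioi (0 : ℝ), Complex.exp (-μ * t) * (f - g) t = 0 := by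
    intro μ hμ
    simp only [Pi.sub_apply, mul_sub]
    rw [integral_sub (integrableOn_exp_mul_of_bounded (hmeas f hf) hfb hμ)
      (integrableOn_exp_mul_of_bounded (hmeas g hg) hgb hμ), hL μ hμ, sub_self]
  have hi := fun (μ : ℝ) (hμ : 0 < μ) ↦
    integrableOn_exp_mul_of_bounded (hmeas _ (hf.sub hg)) hd hμ
  have hexp : ∀ (μ t : ℝ), Complex.exp (-μ * t) = (Real.exp (-μ * t) : ℂ) := by
    intro μ t; push_cast; rfl
  have hre := eq_zero_of_laplace_eq_zero_real (h := fun t ↦ ((f - g) t).re)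
    (Complex.continuous_re.comp_continuousOn (hf.sub hg))
    (fun t ht ↦ (Complex.abs_re_le_norm _).trans (hd t ht)) fun μ hμ ↦ by
      have := congrArg Complex.re (hint μ hμ)
      rw [← RCLike.re_eq_complex_re, ← integral_re (hi μ hμ)] at this
      simpa only [hexp, RCLike.re_eq_complex_re, Complex.re_ofReal_mul, map_zero] using this
  have him := eq_zero_of_laplace_eq_zero_real (h := fun t ↦ ((f - g) t).im)
    (Complex.continuous_im.comp_continuousOn (hf.sub hg))
    (fun t ht ↦ (Complex.abs_im_le_norm _).trans (hd t ht)) fun μ hμ ↦ by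
      have := congrArg Complex.im (hint μ hμ)
      rw [← RCLike.im_eq_complex_im, ← integral_im (hi μ hμ)] at this
      simpa only [hexp, RCLike.im_eq_complex_im, Complex.im_ofReal_mul, map_zero] using this
  intro t ht
  exact sub_eq_zero.1 (Complex.ext (hre t ht) (him t ht))

end LaplaceUniqueness

/-! ### Right-continuous functions and Riemann sums -/

section RiemannSum

/-- The smallest multiple of `s / (n + 1)` which is at least `r`. -/
noncomputable def gridCeil (s : ℝ) (n : ℕ) (r : ℝ) : ℝ := s / (n + 1) * ⌈r * (n + 1) / s⌉

lemma le_gridCeil {s : ℝ} (hs : 0 < s) (n : ℕ) (r : ℝ) : r ≤ gridCeil s n r := by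
  have h := Int.le_ceil (r * (n + 1) / s)
  calc r = s / (n + 1) * (r * (n + 1) / s) := by field_simp
    _ ≤ _ := by rw [gridCeil]; gcongr

lemma gridCeil_le {s : ℝ} (hs : 0 < s) (n : ℕ) (r : ℝ) : gridCeil s n r ≤ r + s / (n + 1) := by
  have h := (Int.ceil_lt_add_one (r * (n + 1) / s)).le
  calc gridCeil s n r ≤ s / (n + 1) * (r * (n + 1) / s + 1) := by rw [gridCeil]; gcongr
    _ = _ := by field_simp

lemma tendsto_gridCeil {s : ℝ} (hs : 0 < s) (r : ℝ) :
    Tendsto (fun n ↦ gridCeil s n r) atTop (𝓝[≥] r) := by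
  refine tendsto_nhdsWithin_iff.2 ⟨?_, Eventually.of_forall fun n ↦ le_gridCeil hs n r⟩
  refine tendsto_of_tendsto_of_tendsto_of_le_of_le tendsto_const_nhds ?_
    (fun n ↦ le_gridCeil hs n r) (fun n ↦ gridCeil_le hs n r)
  have : Tendsto (fun n : ℕ ↦ r + s * (1 / ((n : ℝ) + 1))) atTop (𝓝 (r + s * 0)) :=
    tendsto_const_nhds.add (tendsto_one_div_add_atTop_nhds_zero_nat.const_mul s)
  simpa [div_eq_mul_inv] using this

lemma gridCeil_eq {s : ℝ} (hs : 0 < s) {n k : ℕ} {r : ℝ}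
    (hr : r ∈ Set.Ioc (s / (n + 1) * k) (s / (n + 1) * (k + 1 : ℕ))) :
    gridCeil s n r = s / (n + 1) * (k + 1 : ℕ) := by
  have : ⌈r * (n + 1) / s⌉ = ((k + 1 : ℕ) : ℤ) := by
    rw [Int.ceil_eq_iff]
    have h1 : s / (n + 1) * k * ((n + 1) / s) = k := by field_simp
    have h2 : s / (n + 1) * (k + 1 : ℕ) * ((n + 1) / s) = (k + 1 : ℕ) := by field_simp
    have hpos : 0 < ((n : ℝ) + 1) / s := by positivity
    have e : r * (n + 1) / s = r * ((n + 1) / s) := by ring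
    rw [e]
    constructor
    · have := mul_lt_mul_of_pos_right hr.1 hpos
      rw [h1] at this
      push_cast
      linarith
    · have := mul_le_mul_of_nonneg_right hr.2 hpos.le
      rw [h2] at this
      exact_mod_cast this
  rw [gridCeil, this]
  norm_cast

/-- Right Riemann sums of a bounded right-continuous function converge to its integral. -/
lemma tendsto_riemannSum {g : ℝ → ℝ} (hg : Measurable g) (hb : ∀ x, |g x| ≤ 1)
    (hc : ∀ x, ContinuousWithinAt g (Set.Ici x) x) {s : ℝ} (hs : 0 ≤ s) :
    Tendsto (fun n : ℕ ↦ ∑ k ∈ Finset.range (n + 1), s / (n + 1) * g (s / (n + 1) * (k + 1 : ℕ)))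
      atTop (𝓝 (∫ r in (0 : ℝ)..s, g r)) := by
  rcases hs.eq_or_lt with rfl | hs
  · simp
  have hdm : ∀ n, Measurable (gridCeil s n) := fun n ↦ by
    unfold gridCeil
    exact ((measurable_from_top (f := fun z : ℤ ↦ (z : ℝ))).comp (Int.measurable_ceil.comp
      ((measurable_id.mul_const _).div_const _))).const_mul _
  have hii : ∀ n a b, IntervalIntegrable (fun r ↦ g (gridCeil s n r)) volume a b := fun n a b ↦
    intervalIntegrable_const (c := (1 : ℝ)) |>.mono_fun
      (hg.comp (hdm n)).aestronglyMeasurable (ae_of_all _ fun r ↦ by simpa using hb _)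
  -- The Riemann sum is the integral of a step function that evaluates `g` slightly to the right of
  -- `r`; right-continuity and domination then give the limit.
  have hsum : ∀ n : ℕ, ∫ r in (0 : ℝ)..s, g (gridCeil s n r)
      = ∑ k ∈ Finset.range (n + 1), s / (n + 1) * g (s / (n + 1) * (k + 1 : ℕ)) := by
    intro n
    have h := intervalIntegral.sum_integral_adjacent_intervals
      (a := fun k : ℕ ↦ s / (n + 1) * k) (n := n + 1) (f := fun r ↦ g (gridCeil s n r))
      (μ := volume) (fun k _ ↦ hii n _ _)
    have e0 : s / ((n : ℝ) + 1) * ((0 : ℕ) : ℝ) = 0 := by simp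
    have e1 : s / ((n : ℝ) + 1) * ((n + 1 : ℕ) : ℝ) = s := by push_cast; field_simp
    simp only [e0, e1] at h
    rw [← h]
    refine Finset.sum_congr rfl fun k _ ↦ ?_
    have hle : s / ((n : ℝ) + 1) * (k : ℝ) ≤ s / ((n : ℝ) + 1) * ((k + 1 : ℕ) : ℝ) := by
      gcongr; simp
    rw [intervalIntegral.integral_of_le hle,
      setIntegral_congr_fun measurableSet_Ioc (g := fun _ ↦ g (s / (n + 1) * (k + 1 : ℕ)))
        (fun r hr ↦ by simp only [gridCeil_eq hs hr]), ← intervalIntegral.integral_of_le hle,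
      intervalIntegral.integral_const, smul_eq_mul]
    push_cast
    ring
  simp_rw [← hsum]
  refine intervalIntegral.tendsto_integral_filter_of_dominated_convergence (fun _ ↦ 1)
    (Eventually.of_forall fun n ↦ (hg.comp (hdm n)).aestronglyMeasurable)
    (Eventually.of_forall fun n ↦ ae_of_all _ fun r _ ↦ hb _) intervalIntegrable_const
    (ae_of_all _ fun r _ ↦ ?_)
  exact (hc r).tendsto.comp (tendsto_gridCeil hs r)

end RiemannSum

/-! ### Velocity and position along a path of a counting process -/

section Path

/-- The sign `(-1) ^ n t` attached to a counting path `n`. -/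
def signPath (n : ℝ≥0 → ℕ) (r : ℝ) : ℝ := (-1) ^ n r.toNNReal

/-- The position `∫₀ᵗ (-1) ^ n s ds` attached to a counting path `n`. -/
noncomputable def positionPath (n : ℝ≥0 → ℕ) (t : ℝ) : ℝ := ∫ s in (0 : ℝ)..t, signPath n s

variable {n : ℝ≥0 → ℕ}

lemma abs_signPath (r : ℝ) : |signPath n r| = 1 := by simp [signPath]

lemma measurable_signPath (hn : Monotone n) : Measurable (signPath n) :=
  (measurable_of_countable (fun k : ℕ ↦ (-1 : ℝ) ^ k)).comp
    (hn.measurable.comp measurable_real_toNNReal)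

lemma intervalIntegrable_signPath (hn : Monotone n) (a b : ℝ) :
    IntervalIntegrable (signPath n) volume a b :=
  (intervalIntegrable_const (c := (1 : ℝ))).mono_fun
    (measurable_signPath hn).aestronglyMeasurable
    (ae_of_all _ fun r ↦ by simp [abs_signPath])

lemma continuousWithinAt_signPath (hc : ∀ t, ContinuousWithinAt n (Set.Ici t) t) (x : ℝ) :
    ContinuousWithinAt (signPath n) (Set.Ici x) x := by
  have h1 : ContinuousWithinAt (fun r : ℝ ↦ n r.toNNReal) (Set.Ici x) x :=
    (hc x.toNNReal).comp continuous_real_toNNReal.continuousWithinAt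
      fun y hy ↦ Real.toNNReal_le_toNNReal hy
  exact (continuous_of_discreteTopology (f := fun k : ℕ ↦ (-1 : ℝ) ^ k)).continuousAt
    |>.comp_continuousWithinAt h1

lemma continuous_positionPath (hn : Monotone n) : Continuous (positionPath n) :=
  intervalIntegral.continuous_primitive (intervalIntegrable_signPath hn) 0

lemma hasDerivWithinAt_positionPath (hn : Monotone n)
    (hc : ∀ t, ContinuousWithinAt n (Set.Ici t) t) (x : ℝ) :
    HasDerivWithinAt (positionPath n) (signPath n x) (Set.Ioi x) x :=
  (intervalIntegral.integral_hasDerivWithinAt_right (s := Set.Ici x) (t := Set.Ioi x)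
    (intervalIntegrable_signPath hn 0 x)
    (measurable_signPath hn).stronglyMeasurable.stronglyMeasurableAtFilter
    ((continuousWithinAt_signPath hc x).mono Set.Ioi_subset_Ici_self)).mono
    Set.Ioi_subset_Ici_self

lemma norm_exp_I_mul_mul (κ x : ℝ) : ‖Complex.exp (Complex.I * κ * x)‖ = 1 := by
  rw [mul_assoc, ← Complex.ofReal_mul, mul_comm, Complex.norm_exp_ofReal_mul_I]

/-- The position need not be differentiable at the jumps of `n`, but it is continuous with right
derivative `signPath n` everywhere, and the fundamental theorem of calculus holds for right
derivatives. -/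
lemma exp_positionPath (hn : Monotone n) (hc : ∀ t, ContinuousWithinAt n (Set.Ici t) t)
    (κ t : ℝ) :
    Complex.exp (Complex.I * κ * positionPath n t) = 1 + Complex.I * κ *
      ∫ s in (0 : ℝ)..t, signPath n s * Complex.exp (Complex.I * κ * positionPath n s) := by
  have hcont : Continuous fun s ↦ Complex.exp (Complex.I * κ * positionPath n s) := by
    have := continuous_positionPath hn
    fun_prop
  have hmeas : Measurable fun s ↦ (signPath n s : ℂ) := Complex.measurable_ofReal.comp
    (measurable_signPath hn)
  have h := intervalIntegral.integral_eq_sub_of_hasDeriv_right (a := 0) (b := t)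
    (f := fun s ↦ Complex.exp (Complex.I * κ * positionPath n s))
    (f' := fun s ↦ Complex.I * κ *
      (signPath n s * Complex.exp (Complex.I * κ * positionPath n s)))
    hcont.continuousOn (fun x _ ↦ ?_) ?_
  · rw [intervalIntegral.integral_const_mul] at h
    rw [h]
    simp [positionPath]
  · have h1 := (hasDerivWithinAt_positionPath hn hc x).ofReal_comp
    exact ((h1.const_mul (Complex.I * κ)).cexp).congr_deriv (by ring)
  · refine (intervalIntegrable_const (c := |κ|)).mono_fun
      ((hmeas.mul hcont.measurable).const_mul _).aestronglyMeasurable (ae_of_all _ fun r ↦ ?_)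
    simp [norm_exp_I_mul_mul, abs_signPath]

end Path

/-! ### The Fourier transform of the position of a Poisson-switched motion -/

section Poisson

variable {Ω : Type*} [MeasurableSpace Ω] {P : Measure Ω}
  {lam : ℝ≥0} {N : ℝ≥0 → Ω → ℕ}

/-- The generating function `exp (r (z - 1))` at `z = -1`. -/
lemma integral_neg_one_pow_poissonMeasure (r : ℝ≥0) :
    ∫ k, (-1 : ℝ) ^ k ∂(poissonMeasure r) = Real.exp (-2 * r) := by
  have h : HasSum (fun k : ℕ ↦ (-(r : ℝ)) ^ k / k.factorial) (Real.exp (-r)) := by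
    rw [Real.exp_eq_exp_ℝ]
    exact NormedSpace.expSeries_div_hasSum_exp (-(r : ℝ))
  rw [integral_poissonMeasure]
  have h2 := (h.mul_left (Real.exp (-r))).tsum_eq
  rw [← Real.exp_add] at h2
  rw [show -2 * (r : ℝ) = -r + -r by ring, ← h2]
  refine tsum_congr fun k ↦ ?_
  rw [smul_eq_mul, neg_pow (r : ℝ)]
  ring

namespace IsPoissonProcess

lemma ae_path (hN : IsPoissonProcess lam N P) :
    ∀ᵐ ω ∂P, Monotone (fun t ↦ N t ω) ∧
      (∀ t, ContinuousWithinAt (fun s ↦ N s ω) (Set.Ici t) t) ∧ N 0 ω = 0 := by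
  filter_upwards [hN.monotone, hN.right_continuous, hN.zero] with ω h1 h2 h3 using ⟨h1, h2, h3⟩

lemma measurable_sign (hN : IsPoissonProcess lam N P) (r : ℝ) :
    Measurable (fun ω ↦ signPath (fun t ↦ N t ω) r) :=
  (measurable_of_countable (fun k : ℕ ↦ (-1 : ℝ) ^ k)).comp (hN.measurable _)

/-- Riemann sums see `N` at finitely many times only; measurability and independence of the position
are reached through them. -/
lemma tendsto_riemannSum_position (hN : IsPoissonProcess lam N P) {s : ℝ} (hs : 0 ≤ s) :
    ∀ᵐ ω ∂P, Tendsto (fun n : ℕ ↦ ∑ k ∈ Finset.range (n + 1),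
      s / (n + 1) * signPath (fun t ↦ N t ω) (s / (n + 1) * (k + 1 : ℕ)))
      atTop (𝓝 (positionPath (fun t ↦ N t ω) s)) := by
  filter_upwards [hN.ae_path] with ω h
  exact tendsto_riemannSum (measurable_signPath h.1) (fun x ↦ (abs_signPath x).le)
    (continuousWithinAt_signPath h.2.1) hs

lemma aemeasurable_position (hN : IsPoissonProcess lam N P) {s : ℝ} (hs : 0 ≤ s) :
    AEMeasurable (fun ω ↦ positionPath (fun t ↦ N t ω) s) P := by
  refine aemeasurable_of_tendsto_metrizable_ae atTop (fun n ↦ ?_) (hN.tendsto_riemannSum_position hs)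
  exact (Finset.measurable_fun_sum _ fun k _ ↦ (hN.measurable_sign _).const_mul _).aemeasurable

lemma integral_sign_mul_sign (hN : IsPoissonProcess lam N P) {s t : ℝ} (hs : 0 ≤ s)
    (hst : s ≤ t) :
    ∫ ω, signPath (fun t ↦ N t ω) t * signPath (fun t ↦ N t ω) s ∂P
      = Real.exp (-2 * lam * (t - s)) := by
  have h := hN.law_increments s.toNNReal (t - s).toNNReal
  rw [← Real.toNNReal_add hs (sub_nonneg.2 hst), add_sub_cancel] at h
  have h2 := h.integral_comp (f := fun k : ℕ ↦ (-1 : ℝ) ^ k)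
    (measurable_of_countable _).aestronglyMeasurable
  rw [integral_neg_one_pow_poissonMeasure] at h2
  push_cast at h2
  rw [Real.coe_toNNReal _ (sub_nonneg.2 hst), ← mul_assoc] at h2
  rw [← h2]
  refine integral_congr_ae ?_
  filter_upwards [hN.monotone] with ω hω
  have hle := hω (Real.toNNReal_le_toNNReal hst)
  simp only [Function.comp, signPath]
  rw [← pow_add]
  -- Monotonicity makes the truncated subtraction exact, and the even part `2 * N s` does not affect
  -- the sign.
  have : N t.toNNReal ω + N s.toNNReal ω
      = (N t.toNNReal ω - N s.toNNReal ω) + 2 * N s.toNNReal ω := by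
    simp only at hle; omega
  rw [this, pow_add, pow_mul]
  simp

/-- The sum is a function of the increments of `N` along a mesh of `[0, s]`, while the product of
signs is the parity of the increment from `s` to `t`. -/
lemma indepFun_riemannSum_sign (hN : IsPoissonProcess lam N P) {s t : ℝ} (hs : 0 ≤ s)
    (hst : s ≤ t) (n : ℕ) :
    IndepFun (fun ω ↦ ∑ k ∈ Finset.range (n + 1),
        s / (n + 1) * signPath (fun t ↦ N t ω) (s / (n + 1) * (k + 1 : ℕ)))
      (fun ω ↦ signPath (fun t ↦ N t ω) t * signPath (fun t ↦ N t ω) s) P := by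
  -- The mesh reaches `s` at index `n + 1` and stays at `t` afterwards, so increment number `n + 1`
  -- is `N t - N s`.
  set τ : ℕ → ℝ≥0 := fun k ↦ if k ≤ n + 1 then (s / (n + 1) * k).toNNReal else t.toNNReal with hτ
  have hlast : s / ((n : ℝ) + 1) * ((n + 1 : ℕ) : ℝ) = s := by push_cast; field_simp
  have hmono : Monotone τ := by
    refine monotone_nat_of_le_succ fun k ↦ ?_
    simp only [hτ]
    split_ifs with h1 h2 h2
    · refine Real.toNNReal_le_toNNReal ?_
      gcongr; simp
    · refine Real.toNNReal_le_toNNReal (le_trans ?_ hst)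
      calc s / ((n : ℝ) + 1) * k ≤ s / ((n : ℝ) + 1) * ((n + 1 : ℕ) : ℝ) := by gcongr
        _ = s := hlast
    · omega
    · exact le_rfl
  set I : ℕ → Ω → ℤ := fun i ω ↦ (N (τ (i + 1)) ω : ℤ) - N (τ i) ω with hI
  have hIm : ∀ i, Measurable (I i) := fun i ↦
    ((measurable_of_countable (fun k : ℕ ↦ (k : ℤ))).comp (hN.measurable _)).sub
      ((measurable_of_countable (fun k : ℕ ↦ (k : ℤ))).comp (hN.measurable _))
  have hind : iIndepFun I P := hN.indep_increments.nat hmono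
  have h := hind.indepFun_finset (Finset.range (n + 1)) {n + 1} (by simp) hIm
  have h' := h.comp
    -- Since `N 0 = 0`, the increments with index at most `k` telescope to `N` at mesh point `k +
    -- 1`.
    (φ := fun x : (Finset.range (n + 1) → ℤ) ↦ ∑ k ∈ Finset.range (n + 1),
      s / ((n : ℝ) + 1) * (-1 : ℝ) ^ (∑ j : Finset.range (n + 1), if j.1 ≤ k then x j else 0))
    (ψ := fun x : (({n + 1} : Finset ℕ) → ℤ) ↦ (-1 : ℝ) ^ x ⟨n + 1, by simp⟩)
    (measurable_of_countable _) (measurable_of_countable _)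
  refine h'.congr ?_ ?_
  · filter_upwards [hN.zero] with ω hω
    simp only [Function.comp]
    refine Finset.sum_congr rfl fun k hk ↦ ?_
    have hk' : k + 1 ≤ n + 1 := by simpa [Nat.lt_iff_add_one_le] using hk
    have hsum : (∑ j : Finset.range (n + 1), if j.1 ≤ k then I j.1 ω else 0)
        = (N (τ (k + 1)) ω : ℤ) := by
      rw [Finset.sum_coe_sort (Finset.range (n + 1)) (fun j ↦ if j ≤ k then I j ω else 0),
        ← Finset.sum_filter]
      have : (Finset.range (n + 1)).filter (fun j ↦ j ≤ k) = Finset.range (k + 1) := by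
        ext j; simp; omega
      rw [this, Finset.sum_range_sub (fun i ↦ (N (τ i) ω : ℤ))]
      simp [hτ, hω]
    rw [hsum, zpow_natCast]
    simp only [hτ, if_pos hk', signPath]
  · refine ae_of_all _ fun ω ↦ ?_
    have e1 : τ (n + 1 + 1) = t.toNNReal := by simp [hτ]
    have e2 : τ (n + 1) = s.toNNReal := by simp only [hτ, le_refl, if_true, hlast]
    simp only [Function.comp, hI, e1, e2, signPath]
    rw [zpow_sub₀ (by norm_num), zpow_natCast, zpow_natCast, div_eq_mul_inv, ← inv_pow]
    norm_num

/-- The increments of `N` after `s` are independent of the position at time `s`. -/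
lemma integral_sign_mul_sign_mul_exp [IsProbabilityMeasure P] (hN : IsPoissonProcess lam N P) (κ : ℝ) {s t : ℝ}
    (hs : 0 ≤ s) (hst : s ≤ t) :
    ∫ ω, (signPath (fun t ↦ N t ω) t : ℂ) * (signPath (fun t ↦ N t ω) s *
        Complex.exp (Complex.I * κ * positionPath (fun t ↦ N t ω) s)) ∂P
      = Complex.exp (-2 * lam * (t - s)) *
        ∫ ω, Complex.exp (Complex.I * κ * positionPath (fun t ↦ N t ω) s) ∂P := by
  set R : ℕ → Ω → ℝ := fun n ω ↦ ∑ k ∈ Finset.range (n + 1),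
        s / (n + 1) * signPath (fun t ↦ N t ω) (s / (n + 1) * (k + 1 : ℕ)) with hR
  set S : Ω → ℝ := fun ω ↦ signPath (fun t ↦ N t ω) t * signPath (fun t ↦ N t ω) s with hS
  have hRm : ∀ n, Measurable (R n) := fun n ↦
    Finset.measurable_fun_sum _ fun k _ ↦ (hN.measurable_sign _).const_mul _
  have hSm : Measurable S := (hN.measurable_sign _).mul (hN.measurable_sign _)
  have hem : Measurable fun x : ℝ ↦ Complex.exp (Complex.I * κ * x) := by fun_prop
  have hlim := hN.tendsto_riemannSum_position hs
  have hce : Continuous fun x : ℝ ↦ Complex.exp (Complex.I * κ * x) := by fun_prop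
  have hSn : ∀ ω, ‖(S ω : ℂ)‖ = 1 := fun ω ↦ by simp [hS, abs_signPath]
  have hES : ∫ ω, (S ω : ℂ) ∂P = Complex.exp (-2 * lam * (t - s)) := by
    rw [integral_complex_ofReal, hN.integral_sign_mul_sign hs hst]
    push_cast
    rfl
  have h1 : Tendsto (fun n ↦ ∫ ω, (S ω : ℂ) * Complex.exp (Complex.I * κ * R n ω) ∂P) atTop
      (𝓝 (∫ ω, (S ω : ℂ) * Complex.exp (Complex.I * κ * positionPath (fun t ↦ N t ω) s) ∂P)) := by
    refine tendsto_integral_of_dominated_convergence (fun _ ↦ 1) (fun n ↦ ?_)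
      (integrable_const _) (fun n ↦ ae_of_all _ fun ω ↦ ?_) ?_
    · exact ((Complex.measurable_ofReal.comp hSm).mul
        (hem.comp (hRm n))).aestronglyMeasurable
    · rw [norm_mul, hSn, norm_exp_I_mul_mul, one_mul]
    · filter_upwards [hlim] with ω hω
      exact ((hce.tendsto _).comp hω).const_mul _
  have h2 : Tendsto (fun n ↦ ∫ ω, Complex.exp (Complex.I * κ * R n ω) ∂P) atTop
      (𝓝 (∫ ω, Complex.exp (Complex.I * κ * positionPath (fun t ↦ N t ω) s) ∂P)) := by
    refine tendsto_integral_of_dominated_convergence (fun _ ↦ 1) (fun n ↦ ?_)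
      (integrable_const _) (fun n ↦ ae_of_all _ fun ω ↦ ?_) ?_
    · exact (hem.comp (hRm n)).aestronglyMeasurable
    · rw [norm_exp_I_mul_mul]
    · filter_upwards [hlim] with ω hω using (hce.tendsto _).comp hω
  -- The expectation factorises for each Riemann sum; the two limits above carry this over to the
  -- position.
  have heq : ∀ n, ∫ ω, (S ω : ℂ) * Complex.exp (Complex.I * κ * R n ω) ∂P
      = Complex.exp (-2 * lam * (t - s)) * ∫ ω, Complex.exp (Complex.I * κ * R n ω) ∂P := by
    intro n
    have hi := (hN.indepFun_riemannSum_sign hs hst n).symm.comp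
      (φ := fun x : ℝ ↦ (x : ℂ)) Complex.measurable_ofReal hem
    rw [← hES]
    exact hi.integral_mul_eq_mul_integral
      (Complex.measurable_ofReal.comp hSm).aestronglyMeasurable
      (hem.comp (hRm n)).aestronglyMeasurable
  have := tendsto_nhds_unique (h1.congr heq) (h2.const_mul _)
  rw [← this]
  refine integral_congr_ae (ae_of_all _ fun ω ↦ ?_)
  simp only [hS]
  push_cast
  ring

end IsPoissonProcess

end Poisson

/-! ### The linear system for the transforms of position and velocity -/

section SwitchedMotion

variable {Ω : Type*} [MeasurableSpace Ω] {P : Measure Ω}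
  {lam : ℝ≥0} {N : ℝ≥0 → Ω → ℕ}

/-- The Fourier transform of the position `∫₀ᵗ (-1) ^ N s ds`. -/
noncomputable def positionChar (N : ℝ≥0 → Ω → ℕ) (P : Measure Ω) (κ t : ℝ) : ℂ :=
  ∫ ω, Complex.exp (Complex.I * κ * positionPath (fun t ↦ N t ω) t) ∂P

/-- The Fourier transform of the position, weighted by the sign of the velocity. -/
noncomputable def signedPositionChar (N : ℝ≥0 → Ω → ℕ) (P : Measure Ω) (κ t : ℝ) : ℂ :=
  ∫ ω, signPath (fun t ↦ N t ω) t *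
    Complex.exp (Complex.I * κ * positionPath (fun t ↦ N t ω) t) ∂P

lemma norm_positionChar_le [IsProbabilityMeasure P] (κ t : ℝ) : ‖positionChar N P κ t‖ ≤ 1 := by
  simpa [positionChar] using norm_integral_le_of_norm_le_const (μ := P) (C := 1)
    (f := fun ω ↦ Complex.exp (Complex.I * κ * positionPath (fun t ↦ N t ω) t))
    (ae_of_all _ fun ω ↦ (norm_exp_I_mul_mul _ _).le)

lemma norm_signedPositionChar_le [IsProbabilityMeasure P] (κ t : ℝ) :
    ‖signedPositionChar N P κ t‖ ≤ 1 := by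
  simpa [signedPositionChar] using norm_integral_le_of_norm_le_const (μ := P) (C := 1)
    (f := fun ω ↦ (signPath (fun t ↦ N t ω) t : ℂ) *
      Complex.exp (Complex.I * κ * positionPath (fun t ↦ N t ω) t))
    (ae_of_all _ fun ω ↦ by simp [norm_exp_I_mul_mul, abs_signPath])

namespace IsPoissonProcess

lemma aemeasurable_exp_position (hN : IsPoissonProcess lam N P) (κ : ℝ) {s : ℝ} (hs : 0 ≤ s) :
    AEMeasurable (fun ω ↦ Complex.exp (Complex.I * κ * positionPath (fun t ↦ N t ω) s)) P :=
  (by fun_prop : Measurable fun x : ℝ ↦ Complex.exp (Complex.I * κ * x)).comp_aemeasurable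
    (hN.aemeasurable_position hs)

lemma aemeasurable_sign_mul_exp (hN : IsPoissonProcess lam N P) (κ : ℝ) {s : ℝ} (hs : 0 ≤ s) :
    AEMeasurable (fun ω ↦ signPath (fun t ↦ N t ω) s *
      Complex.exp (Complex.I * κ * positionPath (fun t ↦ N t ω) s)) P :=
  (Complex.measurable_ofReal.comp (hN.measurable_sign s)).aemeasurable.mul
    (hN.aemeasurable_exp_position κ hs)

variable [IsProbabilityMeasure P]

lemma aemeasurable_uncurry_sign_mul_exp (hN : IsPoissonProcess lam N P) (κ t : ℝ) :
    AEMeasurable (fun p : ℝ × Ω ↦ signPath (fun t ↦ N t p.2) p.1 *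
      Complex.exp (Complex.I * κ * positionPath (fun t ↦ N t p.2) p.1))
      ((volume.restrict (Set.Ioc 0 t)).prod P) := by
  have h := aemeasurable_uncurry_toNNReal (P := P)
    (Y := fun (u : ℝ≥0) ω ↦ (signPath (fun t ↦ N t ω) u : ℂ) *
      Complex.exp (Complex.I * κ * positionPath (fun t ↦ N t ω) u))
    (fun s ↦ hN.aemeasurable_sign_mul_exp κ s.2) ?_ (volume.restrict (Set.Ioc 0 t))
  · refine h.congr ?_
    have : ∀ᵐ x ∂(volume.restrict (Set.Ioc 0 t)), 0 ≤ x := by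
      filter_upwards [ae_restrict_mem measurableSet_Ioc] with x hx using hx.1.le
    filter_upwards [Measure.quasiMeasurePreserving_fst.ae this] with p hp
    simp only [Real.coe_toNNReal _ hp]
  · filter_upwards [hN.ae_path] with ω hω s
    have h1 : ContinuousWithinAt (fun u : ℝ≥0 ↦ signPath (fun t ↦ N t ω) u) (Set.Ici s) s :=
      (continuousWithinAt_signPath hω.2.1 (s : ℝ)).comp
        NNReal.continuous_coe.continuousWithinAt fun u hu ↦ NNReal.coe_le_coe.2 hu
    have h2 : Continuous fun u : ℝ≥0 ↦
        Complex.exp (Complex.I * κ * positionPath (fun t ↦ N t ω) u) := by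
      have := continuous_positionPath hω.1
      fun_prop
    exact (Complex.continuous_ofReal.continuousAt.comp_continuousWithinAt h1).mul
      h2.continuousWithinAt

/-- Fubini with a bounded weight, which is `1` for `positionChar` and the sign at time `t` for
`signedPositionChar`. -/
lemma integral_mul_integral_sign_mul_exp (hN : IsPoissonProcess lam N P) (κ : ℝ) {t : ℝ}
    (ht : 0 ≤ t) {Z : Ω → ℂ} (hZ : Measurable Z) (hb : ∀ ω, ‖Z ω‖ ≤ 1) :
    ∫ ω, Z ω * (∫ s in (0 : ℝ)..t, signPath (fun t ↦ N t ω) s *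
        Complex.exp (Complex.I * κ * positionPath (fun t ↦ N t ω) s)) ∂P
      = ∫ s in (0 : ℝ)..t, ∫ ω, Z ω * (signPath (fun t ↦ N t ω) s *
        Complex.exp (Complex.I * κ * positionPath (fun t ↦ N t ω) s)) ∂P := by
  simp_rw [intervalIntegral.integral_of_le ht, ← integral_const_mul]
  refine (integral_integral_swap (μ := volume.restrict (Set.Ioc 0 t)) (ν := P)
    (f := fun s ω ↦ Z ω * (signPath (fun t ↦ N t ω) s *
      Complex.exp (Complex.I * κ * positionPath (fun t ↦ N t ω) s))) ?_).symm
  refine (integrable_const (1 : ℝ)).mono'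
    ((hZ.comp measurable_snd).aemeasurable.mul
      (hN.aemeasurable_uncurry_sign_mul_exp κ t)).aestronglyMeasurable (ae_of_all _ fun p ↦ ?_)
  simpa [Function.uncurry, norm_exp_I_mul_mul, abs_signPath] using hb p.2

lemma positionChar_eq (hN : IsPoissonProcess lam N P) (κ : ℝ) {t : ℝ} (ht : 0 ≤ t) :
    positionChar N P κ t
      = 1 + Complex.I * κ * ∫ s in (0 : ℝ)..t, signedPositionChar N P κ s := by
  have h := hN.integral_mul_integral_sign_mul_exp κ ht (Z := fun _ ↦ 1) measurable_const (by simp)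
  simp only [one_mul] at h
  have hae : (fun ω ↦ Complex.exp (Complex.I * κ * positionPath (fun t ↦ N t ω) t)) =ᵐ[P]
      fun ω ↦ 1 + Complex.I * κ * ∫ s in (0 : ℝ)..t, signPath (fun t ↦ N t ω) s *
        Complex.exp (Complex.I * κ * positionPath (fun t ↦ N t ω) s) := by
    filter_upwards [hN.ae_path] with ω hω using exp_positionPath hω.1 hω.2.1 κ t
  have hint : Integrable (fun ω ↦ Complex.I * κ *
      ∫ s in (0 : ℝ)..t, signPath (fun t ↦ N t ω) s *
        Complex.exp (Complex.I * κ * positionPath (fun t ↦ N t ω) s)) P := by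
    have h1 : Integrable
        (fun ω ↦ Complex.exp (Complex.I * κ * positionPath (fun t ↦ N t ω) t)) P :=
      (integrable_const (1 : ℝ)).mono' (hN.aemeasurable_exp_position κ ht).aestronglyMeasurable
        (ae_of_all _ fun ω ↦ (norm_exp_I_mul_mul _ _).le)
    refine (h1.sub (integrable_const 1)).congr ?_
    filter_upwards [hae] with ω hω
    simp only [Pi.sub_apply]
    rw [hω]; ring
  rw [positionChar, integral_congr_ae hae, integral_add (integrable_const _) hint,
    integral_const_mul, h]
  simp [signedPositionChar]

/-- Multiply `exp_positionPath` by the sign at `t` before averaging. Under the time integral the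
signs at `s` and `t` combine into a factor independent of the position at `s`, so the system closes:
the velocity weight disappears at the cost of `exp (-2 lam (t - s))`. -/
lemma signedPositionChar_eq (hN : IsPoissonProcess lam N P) (κ : ℝ) {t : ℝ} (ht : 0 ≤ t) :
    signedPositionChar N P κ t
      = Complex.exp (-2 * lam * t) * (1 + Complex.I * κ *
        ∫ s in (0 : ℝ)..t, Complex.exp (2 * lam * s) * positionChar N P κ s) := by
  set S : Ω → ℂ := fun ω ↦ signPath (fun t ↦ N t ω) t with hS
  have hSm : Measurable S := Complex.measurable_ofReal.comp (hN.measurable_sign t)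
  have hSb : ∀ ω, ‖S ω‖ ≤ 1 := fun ω ↦ by simp [hS, abs_signPath]
  have h := hN.integral_mul_integral_sign_mul_exp κ ht hSm hSb
  have hae : (fun ω ↦ S ω * Complex.exp (Complex.I * κ * positionPath (fun t ↦ N t ω) t)) =ᵐ[P]
      fun ω ↦ S ω + Complex.I * κ * (S ω * ∫ s in (0 : ℝ)..t, signPath (fun t ↦ N t ω) s *
        Complex.exp (Complex.I * κ * positionPath (fun t ↦ N t ω) s)) := by
    filter_upwards [hN.ae_path] with ω hω
    rw [exp_positionPath hω.1 hω.2.1 κ t]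
    ring
  have hSi : Integrable S P := (integrable_const (1 : ℝ)).mono' hSm.aestronglyMeasurable
    (ae_of_all _ hSb)
  have hint : Integrable (fun ω ↦ Complex.I * κ * (S ω *
      ∫ s in (0 : ℝ)..t, signPath (fun t ↦ N t ω) s *
        Complex.exp (Complex.I * κ * positionPath (fun t ↦ N t ω) s))) P := by
    have h1 : Integrable
        (fun ω ↦ S ω * Complex.exp (Complex.I * κ * positionPath (fun t ↦ N t ω) t)) P :=
      (integrable_const (1 : ℝ)).mono' (hN.aemeasurable_sign_mul_exp κ ht).aestronglyMeasurable
        (ae_of_all _ fun ω ↦ by simp [hS, norm_exp_I_mul_mul, abs_signPath])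
    refine (h1.sub hSi).congr ?_
    filter_upwards [hae] with ω hω
    simp only [Pi.sub_apply]
    rw [hω]; ring
  have hES : ∫ ω, S ω ∂P = Complex.exp (-2 * lam * t) := by
    have h0 := hN.integral_sign_mul_sign le_rfl ht
    have : (fun ω ↦ signPath (fun t ↦ N t ω) t * signPath (fun t ↦ N t ω) 0) =ᵐ[P]
        fun ω ↦ signPath (fun t ↦ N t ω) t := by
      filter_upwards [hN.zero] with ω hω
      simp [signPath, hω]
    rw [integral_congr_ae this] at h0
    rw [hS, integral_complex_ofReal, h0]
    push_cast
    simp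
  have key : ∫ s in (0 : ℝ)..t, ∫ ω, S ω * (signPath (fun t ↦ N t ω) s *
        Complex.exp (Complex.I * κ * positionPath (fun t ↦ N t ω) s)) ∂P
      = Complex.exp (-2 * lam * t) *
        ∫ s in (0 : ℝ)..t, Complex.exp (2 * lam * s) * positionChar N P κ s := by
    rw [← intervalIntegral.integral_const_mul]
    refine intervalIntegral.integral_congr fun s hs ↦ ?_
    rw [Set.uIcc_of_le ht] at hs
    simp only [hS]
    rw [hN.integral_sign_mul_sign_mul_exp κ hs.1 hs.2, ← mul_assoc, ← Complex.exp_add,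
      positionChar]
    congr 2
    ring
  rw [signedPositionChar, integral_congr_ae hae, integral_add hSi hint, integral_const_mul, h, hES,
    key]
  ring

lemma continuous_positionChar_max (hN : IsPoissonProcess lam N P) (κ : ℝ) :
    Continuous fun t ↦ positionChar N P κ (max t 0) := by
  refine continuous_of_dominated (bound := fun _ ↦ 1)
    (fun t ↦ (hN.aemeasurable_exp_position κ (le_max_right _ _)).aestronglyMeasurable)
    (fun t ↦ ae_of_all _ fun ω ↦ (norm_exp_I_mul_mul _ _).le) (integrable_const _) ?_
  filter_upwards [hN.ae_path] with ω hω
  have := continuous_positionPath hω.1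
  fun_prop

/-- The transforms of the position and of the velocity-weighted position solve a linear system. -/
lemma exists_hasDerivAt_positionChar (hN : IsPoissonProcess lam N P) (κ : ℝ) :
    ∃ F G : ℝ → ℂ, (∀ t, HasDerivAt F (Complex.I * κ * G t) t) ∧
      (∀ t, 0 ≤ t → HasDerivAt G (Complex.I * κ * F t - 2 * lam * G t) t) ∧
      (∀ t, 0 ≤ t → F t = positionChar N P κ t) ∧
      (∀ t, 0 ≤ t → G t = signedPositionChar N P κ t) ∧ F 0 = 1 ∧ G 0 = 1 ∧
      Continuous G := by
  -- Clamping the time by `max s 0` makes the integrand continuous on the whole line, so that `G`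
  -- and then `F` have two-sided derivatives even at `0`.
  set G : ℝ → ℂ := fun t ↦ Complex.exp (-2 * lam * t) * (1 + Complex.I * κ *
        ∫ s in (0 : ℝ)..t, Complex.exp (2 * lam * s) * positionChar N P κ (max s 0)) with hG
  have hic : Continuous fun s : ℝ ↦
      Complex.exp (2 * lam * s) * positionChar N P κ (max s 0) := by
    have := hN.continuous_positionChar_max κ
    fun_prop
  have hGd : ∀ t, HasDerivAt G
      (Complex.I * κ * positionChar N P κ (max t 0) - 2 * lam * G t) t := by
    intro t
    have h1 := intervalIntegral.integral_hasDerivAt_right (hic.intervalIntegrable 0 t)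
      hic.stronglyMeasurable.stronglyMeasurableAtFilter hic.continuousAt
    have h2 : HasDerivAt (fun t : ℝ ↦ Complex.exp (-2 * lam * t))
        (Complex.exp (-2 * lam * t) * (-2 * lam * 1)) t :=
      ((Complex.ofRealCLM.hasDerivAt (x := t)).const_mul (-2 * (lam : ℂ))).cexp
    refine (h2.mul ((h1.const_mul (Complex.I * κ)).const_add 1)).congr_deriv ?_
    have : Complex.exp (-2 * lam * t) * Complex.exp (2 * lam * t) = 1 := by
      rw [← Complex.exp_add]; simp
    simp only [hG]
    linear_combination (Complex.I * κ * positionChar N P κ (max t 0)) * this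
  have hGc : Continuous G := continuous_iff_continuousAt.2 fun t ↦ (hGd t).continuousAt
  have hGs : ∀ t, 0 ≤ t → G t = signedPositionChar N P κ t := by
    intro t ht
    rw [hN.signedPositionChar_eq κ ht]
    simp only [hG]
    congr 3
    refine intervalIntegral.integral_congr fun s hs ↦ ?_
    rw [Set.uIcc_of_le ht] at hs
    simp only [max_eq_left hs.1]
  have hFs : ∀ t, 0 ≤ t → 1 + Complex.I * κ * ∫ s in (0 : ℝ)..t, G s = positionChar N P κ t := by
    intro t ht
    rw [hN.positionChar_eq κ ht]
    congr 2
    refine intervalIntegral.integral_congr fun s hs ↦ ?_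
    rw [Set.uIcc_of_le ht] at hs
    exact hGs s hs.1
  refine ⟨fun t ↦ 1 + Complex.I * κ * ∫ s in (0 : ℝ)..t, G s, G, fun t ↦ ?_, fun t ht ↦ ?_, hFs,
    hGs, by simp, by simp [hG], hGc⟩
  · exact ((intervalIntegral.integral_hasDerivAt_right (hGc.intervalIntegrable 0 t)
      hGc.stronglyMeasurable.stronglyMeasurableAtFilter hGc.continuousAt).const_mul _).const_add 1
  · have := hGd t
    rw [max_eq_left ht] at this
    simpa only [hFs t ht] using this

end IsPoissonProcess

end SwitchedMotion

/-! ### The telegraph process -/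

section Telegraph

lemma telegraphMotion_eq {Ω : Type*} (V : Ω → ℝ) (N : ℝ≥0 → Ω → ℕ) (t : ℝ≥0) (ω : Ω) :
    telegraphMotion V N t ω = V ω * positionPath (fun t ↦ N t ω) t := rfl

variable {Ω : Type*} [MeasurableSpace Ω] {P : Measure Ω} {c lam : ℝ≥0}

lemma IsTelegraphProcess.aemeasurable {T : ℝ≥0 → Ω → ℝ} (hT : IsTelegraphProcess c lam T P)
    (t : ℝ≥0) : AEMeasurable (T t) P := by
  obtain ⟨V, N, hV, hN, -, rfl⟩ := hT
  exact hV.aemeasurable.mul (hN.aemeasurable_position t.2)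

lemma IsTelegraphProcess.ae_continuous {T : ℝ≥0 → Ω → ℝ} (hT : IsTelegraphProcess c lam T P) :
    ∀ᵐ ω ∂P, Continuous fun t ↦ T t ω := by
  obtain ⟨V, N, -, hN, -, rfl⟩ := hT
  filter_upwards [hN.ae_path] with ω hω
  simp only [telegraphMotion_eq]
  have := continuous_positionPath hω.1
  fun_prop

lemma ae_eq_or_eq_neg_of_hasLaw {V : Ω → ℝ} (hV : HasLaw V
    ((2⁻¹ : ℝ≥0∞) • Measure.dirac (c : ℝ) + (2⁻¹ : ℝ≥0∞) • Measure.dirac (-(c : ℝ))) P) :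
    ∀ᵐ ω ∂P, V ω = c ∨ V ω = -c := by
  have hm : MeasurableSet {x : ℝ | x = c ∨ x = -c} :=
    (measurableSet_singleton _).union (measurableSet_singleton _)
  refine (hV.ae_iff (p := fun x ↦ x = c ∨ x = -c) (measurableSet_setOfPred.1 hm)).2 ?_
  rw [ae_add_measure_iff]
  constructor
  · exact Measure.ae_smul_measure (by rw [ae_dirac_iff hm]; simp) _
  · exact Measure.ae_smul_measure (by rw [ae_dirac_iff hm]; simp) _

lemma integral_eq_zero_of_hasLaw {V : Ω → ℝ} (hV : HasLaw V
    ((2⁻¹ : ℝ≥0∞) • Measure.dirac (c : ℝ) + (2⁻¹ : ℝ≥0∞) • Measure.dirac (-(c : ℝ))) P) :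
    ∫ ω, (V ω : ℂ) ∂P = 0 := by
  have h := hV.integral_comp (f := fun x : ℝ ↦ (x : ℂ))
    Complex.continuous_ofReal.aestronglyMeasurable
  have hi : ∀ a : ℝ, Integrable (fun x : ℝ ↦ (x : ℂ)) ((2⁻¹ : ℝ≥0∞) • Measure.dirac a) := fun a ↦
    (integrable_dirac (by simp)).smul_measure (by simp)
  rw [integral_add_measure (hi _) (hi _), integral_smul_measure, integral_smul_measure,
    integral_dirac, integral_dirac] at h
  simpa using h

/-- `V` has mean zero and is independent of the path of `N`. Independence applies to
product-measurable functionals such as Riemann sums, and the position is their limit. -/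
lemma IsPoissonProcess.integral_velocity_mul_exp_position [IsProbabilityMeasure P] {V : Ω → ℝ}
    {N : ℝ≥0 → Ω → ℕ} (hV : HasLaw V
      ((2⁻¹ : ℝ≥0∞) • Measure.dirac (c : ℝ) + (2⁻¹ : ℝ≥0∞) • Measure.dirac (-(c : ℝ))) P)
    (hN : IsPoissonProcess lam N P) (hVN : IndepFun V (fun ω t ↦ N t ω) P) (κ : ℝ) {t : ℝ}
    (ht : 0 ≤ t) :
    ∫ ω, (V ω : ℂ) * Complex.exp (Complex.I * κ * positionPath (fun t ↦ N t ω) t) ∂P = 0 := by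
  set R : ℕ → (ℝ≥0 → ℕ) → ℝ := fun n p ↦ ∑ k ∈ Finset.range (n + 1),
        t / (n + 1) * signPath p (t / (n + 1) * (k + 1 : ℕ)) with hR
  have hRm : ∀ n, Measurable (R n) := fun n ↦
    Finset.measurable_fun_sum _ fun k _ ↦ ((measurable_of_countable
      (fun k : ℕ ↦ (-1 : ℝ) ^ k)).comp (measurable_pi_apply _)).const_mul _
  have hNm : Measurable fun ω t ↦ N t ω := measurable_pi_lambda _ hN.measurable
  have hem : Measurable fun x : ℝ ↦ Complex.exp (Complex.I * κ * x) := by fun_prop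
  have hce : Continuous fun x : ℝ ↦ Complex.exp (Complex.I * κ * x) := by fun_prop
  have hVm : AEMeasurable (fun ω ↦ (V ω : ℂ)) P :=
    Complex.measurable_ofReal.comp_aemeasurable hV.aemeasurable
  have hlim : Tendsto (fun n ↦ ∫ ω, (V ω : ℂ) *
      Complex.exp (Complex.I * κ * R n (fun t ↦ N t ω)) ∂P) atTop
      (𝓝 (∫ ω, (V ω : ℂ) * Complex.exp (Complex.I * κ * positionPath (fun t ↦ N t ω) t) ∂P)) := by
    refine tendsto_integral_of_dominated_convergence (fun _ ↦ (c : ℝ)) (fun n ↦ ?_)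
      (integrable_const _) (fun n ↦ ?_) ?_
    · exact (hVm.mul ((hem.comp (hRm n)).comp hNm).aemeasurable).aestronglyMeasurable
    · filter_upwards [ae_eq_or_eq_neg_of_hasLaw hV] with ω hω
      rw [norm_mul, norm_exp_I_mul_mul, mul_one]
      rcases hω with h | h <;> simp [h]
    · filter_upwards [hN.tendsto_riemannSum_position ht] with ω hω
      exact ((hce.tendsto _).comp hω).const_mul _
  refine tendsto_nhds_unique hlim (tendsto_const_nhds.congr fun n ↦ ?_)
  have hi := hVN.comp (φ := fun x : ℝ ↦ (x : ℂ)) Complex.measurable_ofReal (hem.comp (hRm n))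
  have := hi.integral_mul_eq_mul_integral hVm.aestronglyMeasurable
    ((hem.comp (hRm n)).comp hNm).aestronglyMeasurable
  simp only [Function.comp_def, integral_eq_zero_of_hasLaw hV, zero_mul] at this
  exact this.symm

lemma IsPoissonProcess.fourierLaw_telegraphMotion [IsProbabilityMeasure P] {V : Ω → ℝ}
    {N : ℝ≥0 → Ω → ℕ} (hc : 0 < c) (hV : HasLaw V
      ((2⁻¹ : ℝ≥0∞) • Measure.dirac (c : ℝ) + (2⁻¹ : ℝ≥0∞) • Measure.dirac (-(c : ℝ))) P)
    (hN : IsPoissonProcess lam N P) (hVN : IndepFun V (fun ω t ↦ N t ω) P) (ξ : ℝ) (t : ℝ≥0) :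
    fourierLaw (telegraphMotion V N t) P ξ
      = (positionChar N P (c * ξ) t + positionChar N P (-(c * ξ)) t) / 2 := by
  have hc' : (c : ℂ) ≠ 0 := by exact_mod_cast hc.ne'
  -- As `V = ±c`, any function of `V` is affine in `V`; here it is the mean of its values at `±c`
  -- plus `V / (2 c)` times their difference, and the second term has expectation zero.
  have hae : (fun ω ↦ Complex.exp (Complex.I * ξ * telegraphMotion V N t ω)) =ᵐ[P] fun ω ↦
      (Complex.exp (Complex.I * (c * ξ : ℝ) * positionPath (fun t ↦ N t ω) t)
        + Complex.exp (Complex.I * (-(c * ξ) : ℝ) * positionPath (fun t ↦ N t ω) t)) / 2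
      + (V ω * Complex.exp (Complex.I * (c * ξ : ℝ) * positionPath (fun t ↦ N t ω) t)
        - V ω * Complex.exp (Complex.I * (-(c * ξ) : ℝ) * positionPath (fun t ↦ N t ω) t))
        / (2 * c) := by
    filter_upwards [ae_eq_or_eq_neg_of_hasLaw hV] with ω hω
    rw [telegraphMotion_eq]
    rcases hω with h | h
    · rw [h]
      have e : Complex.I * ξ * ((c * positionPath (fun t ↦ N t ω) t : ℝ) : ℂ)
        = Complex.I * (c * ξ : ℝ) * positionPath (fun t ↦ N t ω) t := by push_cast; ring
      rw [e]
      field_simp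
      push_cast
      ring
    · rw [h]
      have e : Complex.I * ξ * ((-c * positionPath (fun t ↦ N t ω) t : ℝ) : ℂ)
        = Complex.I * (-(c * ξ) : ℝ) * positionPath (fun t ↦ N t ω) t := by push_cast; ring
      rw [e]
      field_simp
      push_cast
      ring
  have hi1 : ∀ κ : ℝ, Integrable
      (fun ω ↦ Complex.exp (Complex.I * κ * positionPath (fun t ↦ N t ω) t)) P := fun κ ↦
    (integrable_const (1 : ℝ)).mono' (hN.aemeasurable_exp_position κ t.2).aestronglyMeasurable
      (ae_of_all _ fun ω ↦ (norm_exp_I_mul_mul _ _).le)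
  have hi2 : ∀ κ : ℝ, Integrable
      (fun ω ↦ V ω * Complex.exp (Complex.I * κ * positionPath (fun t ↦ N t ω) t)) P := by
    intro κ
    refine (integrable_const (c : ℝ)).mono' ((Complex.measurable_ofReal.comp_aemeasurable
      hV.aemeasurable).mul (hN.aemeasurable_exp_position κ t.2)).aestronglyMeasurable ?_
    filter_upwards [ae_eq_or_eq_neg_of_hasLaw hV] with ω hω
    rw [norm_mul, norm_exp_I_mul_mul, mul_one]
    rcases hω with h | h <;> simp [h]
  have hi3 := ((hi1 (c * ξ)).add (hi1 (-(c * ξ)))).div_const 2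
  have hi4 := ((hi2 (c * ξ)).sub (hi2 (-(c * ξ)))).div_const (2 * c)
  simp only [Pi.add_apply, Pi.sub_apply] at hi3 hi4
  rw [fourierLaw, integral_congr_ae hae, integral_add hi3 hi4, integral_div, integral_div,
    integral_add (hi1 _) (hi1 _), integral_sub (hi2 _) (hi2 _),
    hN.integral_velocity_mul_exp_position hV hVN _ t.coe_nonneg,
    hN.integral_velocity_mul_exp_position hV hVN _ t.coe_nonneg]
  simp [positionChar]

/-- The Fourier transform of the telegraph process solves the telegraph equation. -/
lemma IsTelegraphProcess.exists_hasDerivAt_fourierLaw [IsProbabilityMeasure P]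
    {T : ℝ≥0 → Ω → ℝ} (hT : IsTelegraphProcess c lam T P) (hc : 0 < c) (ξ : ℝ) :
    ∃ f h : ℝ → ℂ, (∀ t, HasDerivAt f (h t) t) ∧
      (∀ t, 0 ≤ t → HasDerivAt h (-(c * ξ) ^ 2 * f t - 2 * lam * h t) t) ∧
      f 0 = 1 ∧ h 0 = 0 ∧ Continuous h ∧ (∀ t, 0 ≤ t → ‖f t‖ ≤ 1) ∧
      (∀ t, 0 ≤ t → ‖h t‖ ≤ |c * ξ|) ∧ ∀ t : ℝ≥0, fourierLaw (T t) P ξ = f t := by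
  obtain ⟨V, N, hV, hN, hVN, rfl⟩ := hT
  obtain ⟨F, G, hF, hG, hFe, hGe, hF0, hG0, hGc⟩ := hN.exists_hasDerivAt_positionChar (c * ξ)
  obtain ⟨F', G', hF', hG', hFe', hGe', hF0', hG0', hGc'⟩ :=
    hN.exists_hasDerivAt_positionChar (-(c * ξ))
  -- The average over the frequencies `±c ξ` and its derivative; the difference of `G` and `G'`
  -- appears because the frequencies have opposite signs.
  refine ⟨fun t ↦ (F t + F' t) / 2, fun t ↦ Complex.I * (c * ξ) * ((G t - G' t) / 2),
    fun t ↦ ?_, fun t ht ↦ ?_, ?_, ?_, by fun_prop, fun t ht ↦ ?_, fun t ht ↦ ?_, fun t ↦ ?_⟩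
  · refine (((hF t).add (hF' t)).div_const 2).congr_deriv ?_
    push_cast
    ring
  · refine ((((hG t ht).sub (hG' t ht)).div_const 2).const_mul (Complex.I * (c * ξ))).congr_deriv ?_
    push_cast
    linear_combination ((c * ξ : ℂ) ^ 2 * (F t + F' t) / 2) * Complex.I_sq
  · simp [hF0, hF0']
  · simp [hG0, hG0']
  · simp only
    rw [hFe t ht, hFe' t ht, norm_div, Complex.norm_ofNat, div_le_one (by norm_num)]
    refine (norm_add_le _ _).trans ?_
    linarith [norm_positionChar_le (N := N) (P := P) (c * ξ) t,
      norm_positionChar_le (N := N) (P := P) (-(c * ξ)) t]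
  · have hk : ‖Complex.I * (c * ξ)‖ = |c * ξ| := by simp
    simp only
    rw [hGe t ht, hGe' t ht, norm_mul, hk, norm_div, Complex.norm_ofNat]
    refine mul_le_of_le_one_right (abs_nonneg _) ?_
    rw [div_le_one (by norm_num)]
    refine (norm_sub_le _ _).trans ?_
    linarith [norm_signedPositionChar_le (N := N) (P := P) (c * ξ) t,
      norm_signedPositionChar_le (N := N) (P := P) (-(c * ξ)) t]
  · rw [hN.fourierLaw_telegraphMotion hc hV hVN, ← hFe t t.2, ← hFe' t t.2]

/-- Uniqueness for the telegraph equation. -/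
lemma telegraphEquation_unique {a b : ℂ} {f h f' h' : ℝ → ℂ}
    (hf : ∀ t, 0 ≤ t → HasDerivAt f (h t) t) (hh : ∀ t, 0 ≤ t → HasDerivAt h (a * f t + b * h t) t)
    (hf' : ∀ t, 0 ≤ t → HasDerivAt f' (h' t) t)
    (hh' : ∀ t, 0 ≤ t → HasDerivAt h' (a * f' t + b * h' t) t)
    (h0 : f 0 = f' 0) (h0' : h 0 = h' 0) {t : ℝ} (ht : 0 ≤ t) : f t = f' t := by
  -- As a first-order system the equation has a bounded linear, hence Lipschitz, right-hand side.
  set L : ℂ × ℂ →L[ℂ] ℂ × ℂ := (ContinuousLinearMap.snd ℂ ℂ ℂ).prod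
    (a • ContinuousLinearMap.fst ℂ ℂ ℂ + b • ContinuousLinearMap.snd ℂ ℂ ℂ) with hL
  have key : ∀ (f h : ℝ → ℂ), (∀ t, 0 ≤ t → HasDerivAt f (h t) t) →
      (∀ t, 0 ≤ t → HasDerivAt h (a * f t + b * h t) t) → ∀ t, 0 ≤ t →
      HasDerivAt (fun s ↦ (f s, h s)) (L (f t, h t)) t := by
    intro f h hf hh t ht
    exact (hf t ht).prodMk (hh t ht)
  have h1 := key f h hf hh
  have h2 := key f' h' hf' hh'
  have := ODE_solution_unique (v := fun _ ↦ L) (K := ‖L‖₊) (a := 0) (b := t)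
    (fun _ ↦ L.lipschitz)
    (fun s hs ↦ (h1 s hs.1).continuousAt.continuousWithinAt)
    (fun s hs ↦ (h1 s hs.1).hasDerivWithinAt)
    (fun s hs ↦ (h2 s hs.1).continuousAt.continuousWithinAt)
    (fun s hs ↦ (h2 s hs.1).hasDerivWithinAt) (by simp [h0, h0'])
  exact congrArg Prod.fst (this ⟨ht, le_rfl⟩)

/-- The characteristic roots of `r² + 2 lam r + c² ξ² = 0` are `-lam ± D`, and the weights `(1 ± lam
/ D) / 2` are fixed by the initial value `1` and initial slope `0`. -/
lemma IsTelegraphProcess.fourierLaw_eq [IsProbabilityMeasure P]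
    {T : ℝ≥0 → Ω → ℝ} (hT : IsTelegraphProcess c lam T P) (hc : 0 < c) (t : ℝ≥0) (ξ : ℝ) {D : ℂ}
    (hD : D ^ 2 = (lam : ℂ) ^ 2 - (c : ℂ) ^ 2 * (ξ : ℂ) ^ 2) (hD0 : D ≠ 0) :
    fourierLaw (T t) P ξ = 1 / 2 * ((1 + lam / D) * Complex.exp (-lam * t + t * D)
          + (1 - lam / D) * Complex.exp (-lam * t - t * D)) := by
  obtain ⟨f, h, hf, hh, hf0, hh0, -, -, -, hT⟩ := hT.exists_hasDerivAt_fourierLaw hc ξ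
  rw [hT]
  have hexp : ∀ (r : ℂ) (s : ℝ), HasDerivAt (fun s : ℝ ↦ Complex.exp (s * r))
      (Complex.exp (s * r) * r) s := fun r s ↦ by
    simpa using ((Complex.ofRealCLM.hasDerivAt (x := s)).mul_const r).cexp
  have h1 := telegraphEquation_unique (a := -(c * ξ) ^ 2) (b := -(2 * lam)) (f := f) (h := h)
    (f' := fun s ↦ 1 / 2 * ((1 + lam / D) * Complex.exp (s * (-lam + D))
      + (1 - lam / D) * Complex.exp (s * (-lam - D))))
    (h' := fun s ↦ 1 / 2 * ((1 + lam / D) * (Complex.exp (s * (-lam + D)) * (-lam + D))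
      + (1 - lam / D) * (Complex.exp (s * (-lam - D)) * (-lam - D))))
    (fun s _ ↦ hf s) (fun s hs ↦ (hh s hs).congr_deriv (by ring))
    (fun s _ ↦ (((hexp _ s).const_mul _).add ((hexp _ s).const_mul _)).const_mul _)
    (fun s _ ↦ ((((((hexp _ s).mul_const _).const_mul _)).add
      (((hexp _ s).mul_const _).const_mul _)).const_mul _).congr_deriv ?_)
    ?_ ?_ t.2
  · refine h1.trans ?_
    simp only [NNReal.val_eq_coe]
    congr 4 <;> ring_nf
  · field_simp
    have : (c : ℂ) ^ 2 * ξ ^ 2 = lam ^ 2 - D ^ 2 := by rw [hD]; ring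
    rw [this]
    ring
  · rw [hf0]; simp; ring
  · rw [hh0]; simp; field_simp; ring

/-- Here `-lam` is a double root, so the second solution carries a factor `t`. -/
lemma IsTelegraphProcess.fourierLaw_eq_of_eq_zero [IsProbabilityMeasure P]
    {T : ℝ≥0 → Ω → ℝ} (hT : IsTelegraphProcess c lam T P) (hc : 0 < c) (t : ℝ≥0) (ξ : ℝ)
    (hD : 0 = (lam : ℂ) ^ 2 - (c : ℂ) ^ 2 * (ξ : ℂ) ^ 2) :
    fourierLaw (T t) P ξ = Complex.exp (-lam * t) * (1 + lam * t) := by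
  obtain ⟨f, h, hf, hh, hf0, hh0, -, -, -, hT⟩ := hT.exists_hasDerivAt_fourierLaw hc ξ
  rw [hT]
  have hexp : ∀ (s : ℝ), HasDerivAt (fun s : ℝ ↦ Complex.exp (-lam * s))
      (Complex.exp (-lam * s) * -lam) s := fun s ↦ by
    simpa using ((Complex.ofRealCLM.hasDerivAt (x := s)).const_mul (-lam : ℂ)).cexp
  have hid : ∀ s : ℝ, HasDerivAt (fun s : ℝ ↦ (lam * s : ℂ)) lam s := fun s ↦ by
    simpa using (Complex.ofRealCLM.hasDerivAt (x := s)).const_mul (lam : ℂ)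
  refine telegraphEquation_unique (a := -(c * ξ) ^ 2) (b := -(2 * lam)) (f := f) (h := h)
    (f' := fun s ↦ Complex.exp (-lam * s) * (1 + lam * s))
    (h' := fun s ↦ Complex.exp (-lam * s) * (-lam * (lam * s)))
    (fun s _ ↦ hf s) (fun s hs ↦ (hh s hs).congr_deriv (by ring))
    (fun s _ ↦ ((hexp s).mul ((hid s).const_add 1)).congr_deriv (by ring))
    (fun s _ ↦ ((hexp s).mul ((hid s).const_mul (-lam : ℂ))).congr_deriv ?_)
    (by simp [hf0]) (by simp [hh0]) t.2
  have : (c : ℂ) ^ 2 * ξ ^ 2 = lam ^ 2 := (sub_eq_zero.1 hD.symm).symm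
  rw [mul_pow, this]
  ring

/-- The Laplace transform in time of the Fourier transform of the telegraph process. -/
lemma IsTelegraphProcess.laplace_fourierLaw [IsProbabilityMeasure P]
    {T : ℝ≥0 → Ω → ℝ} (hT : IsTelegraphProcess c lam T P) (hc : 0 < c) (ξ : ℝ) {p : ℝ}
    (hp : 0 < p) :
    ∫ t in Set.Ioi (0 : ℝ), Complex.exp (-p * t) * fourierLaw (T t.toNNReal) P ξ
      = ((p + 2 * lam) / (p ^ 2 + 2 * lam * p + c ^ 2 * ξ ^ 2) : ℝ) := by
  obtain ⟨f, h, hf, hh, hf0, hh0, hhc, hfb, hhb, hT⟩ := hT.exists_hasDerivAt_fourierLaw hc ξ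
  set q : ℝ := p ^ 2 + 2 * lam * p + c ^ 2 * ξ ^ 2 with hq
  have hqpos : 0 < q := by positivity
  have hqc : (q : ℂ) = p ^ 2 + 2 * lam * p + c ^ 2 * ξ ^ 2 := by rw [hq]; push_cast; rfl
  have hq0 : (q : ℂ) ≠ 0 := by exact_mod_cast hqpos.ne'
  have hfc : Continuous f := continuous_iff_continuousAt.2 fun t ↦ (hf t).continuousAt
  have hexp : ∀ (s : ℝ), HasDerivAt (fun s : ℝ ↦ Complex.exp (-p * s))
      (Complex.exp (-p * s) * -p) s := fun s ↦ by
    simpa using ((Complex.ofRealCLM.hasDerivAt (x := s)).const_mul (-p : ℂ)).cexp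
  rw [setIntegral_congr_fun (g := fun t : ℝ ↦ Complex.exp (-p * t) * f t) measurableSet_Ioi
    (fun t ht ↦ by simp only [hT, Real.coe_toNNReal t (le_of_lt ht)])]
  -- Times `exp (-p t)`, this is a primitive of `exp (-p t) * f t`: on differentiating, the equation
  -- for `h` cancels all terms in `h` and leaves `q * f t / q`. The integral is then minus its value
  -- at `0`.
  have hbd : ∀ t : ℝ, 0 ≤ t → ‖-((p + 2 * lam) * f t + h t) / q‖
      ≤ (|p + 2 * lam| + |c * ξ|) / q := by
    intro t ht
    rw [norm_div, norm_neg, Complex.norm_real, Real.norm_of_nonneg hqpos.le]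
    gcongr
    refine (norm_add_le _ _).trans (add_le_add ?_ (hhb t ht))
    rw [norm_mul]
    refine (mul_le_of_le_one_right (norm_nonneg _) (hfb t ht)).trans_eq ?_
    rw [← Real.norm_eq_abs, ← Complex.norm_real]
    push_cast
    rfl
  have hlim : Tendsto (fun t : ℝ ↦ Complex.exp (-p * t) * (-((p + 2 * lam) * f t + h t) / q))
      atTop (𝓝 0) := by
    have he : Tendsto (fun t : ℝ ↦ Real.exp (-(p * t)) * ((|p + 2 * lam| + |c * ξ|) / q)) atTop
        (𝓝 (0 * ((|p + 2 * lam| + |c * ξ|) / q))) :=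
      (Real.tendsto_exp_neg_atTop_nhds_zero.comp
        (tendsto_id.const_mul_atTop hp)).mul_const _
    rw [zero_mul] at he
    refine squeeze_zero_norm' ?_ he
    filter_upwards [eventually_ge_atTop 0] with t ht
    rw [norm_mul, Complex.norm_exp]
    have : (-(p : ℂ) * t).re = -(p * t) := by simp
    rw [this]
    gcongr
    exact hbd t ht
  have hder : ∀ t ∈ Set.Ici (0 : ℝ), HasDerivAt (fun t : ℝ ↦
      Complex.exp (-p * t) * (-((p + 2 * lam) * f t + h t) / q)) (Complex.exp (-p * t) * f t) t := by
    intro t ht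
    refine ((hexp t).mul (((((hf t).const_mul (p + 2 * lam : ℂ)).add
      (hh t ht)).neg).div_const (q : ℂ))).congr_deriv ?_
    simp only [Pi.neg_apply, Pi.add_apply]
    field_simp
    rw [hqc]
    ring
  rw [integral_Ioi_of_hasDerivAt_of_tendsto' hder
    (integrableOn_exp_mul_of_bounded hfc.aestronglyMeasurable hfb hp) hlim]
  simp only [hf0, hh0]
  push_cast
  simp
  ring

end Telegraph

/-! ### First passage times of paths with unit drift -/

section FirstPassage

lemma integrableOn_mul_exp_neg_mul {a : ℝ} (ha : 0 ≤ a) :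
    IntegrableOn (fun s : ℝ ↦ a * Real.exp (-a * s)) (Set.Ioi 0) := by
  rcases ha.eq_or_lt with rfl | ha
  · simp
  · exact (integrableOn_exp_mul_Ioi (neg_neg_of_pos ha) 0).const_mul a

/-- The first passage time of the path `d` above the level `t`. -/
noncomputable def firstPassage (d : ℝ≥0 → ℝ) (t : ℝ≥0) : ℝ≥0 := sInf {s : ℝ≥0 | (t : ℝ) ≤ d s}

/-- The path `d` starts at `0` and grows at least at unit speed. -/
structure HasUnitDrift (d : ℝ≥0 → ℝ) : Prop where
  zero : d 0 = 0
  add_le : ∀ s u : ℝ≥0, d s + u ≤ d (s + u)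

/-- The first passage time, computed along rational times only. -/
noncomputable def gridFirstPassage (t : ℝ≥0) (d : ℝ≥0 → ℝ) : ℝ≥0 :=
  ⨅ p : ℕ × ℕ, if (t : ℝ) ≤ d (p.1 / (p.2 + 1)) then (p.1 / (p.2 + 1) : ℝ≥0) else t

/-- Only countably many coordinates of the path enter, so the inverse inherits measurability and
independence from `H`. The default value `t` is harmless, because unit drift forces passage by time
`t`. -/
lemma measurable_gridFirstPassage (t : ℝ≥0) : Measurable (gridFirstPassage t) := by
  refine Measurable.iInf fun p ↦ ?_
  exact Measurable.ite (measurableSet_le measurable_const (measurable_pi_apply _))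
    measurable_const measurable_const

namespace HasUnitDrift

variable {d : ℝ≥0 → ℝ}

lemma strictMono (hd : HasUnitDrift d) : StrictMono d := by
  intro s r hsr
  have h := hd.add_le s (r - s)
  rw [add_tsub_cancel_of_le hsr.le] at h
  have : (0 : ℝ) < (r - s : ℝ≥0) := NNReal.coe_pos.2 (tsub_pos_of_lt hsr)
  linarith

lemma le_self (hd : HasUnitDrift d) (s : ℝ≥0) : (s : ℝ) ≤ d s := by
  simpa [hd.zero] using hd.add_le 0 s

lemma firstPassage_le_of_le {t s : ℝ≥0} (h : (t : ℝ) ≤ d s) :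
    firstPassage d t ≤ s :=
  csInf_le (OrderBot.bddBelow _) h

lemma firstPassage_le_self (hd : HasUnitDrift d) (t : ℝ≥0) : firstPassage d t ≤ t :=
  firstPassage_le_of_le (hd.le_self t)

/-- With `lt_of_lt_firstPassage` this is the duality between a path and its inverse, exact up to the
single time `s = firstPassage d t`. -/
lemma le_firstPassage (hd : HasUnitDrift d) {t s : ℝ≥0} (h : d s < t) : s ≤ firstPassage d t :=
  le_csInf ⟨t, hd.le_self t⟩ fun _ hr ↦ (hd.strictMono.lt_iff_lt.1 (h.trans_le hr)).le

lemma lt_of_lt_firstPassage {t s : ℝ≥0} (h : s < firstPassage d t) : d s < t := by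
  by_contra hn
  exact h.not_ge (firstPassage_le_of_le (not_lt.1 hn))

lemma monotone_firstPassage (hd : HasUnitDrift d) : Monotone (firstPassage d) := by
  intro t r htr
  refine le_csInf ⟨r, hd.le_self r⟩ fun s hs ↦ firstPassage_le_of_le ?_
  exact (NNReal.coe_le_coe.2 htr).trans hs

/-- In `u` further units of time the drift alone raises the path by `u`. This makes the inverse
`1`-Lipschitz, whatever the jumps of the path. -/
lemma firstPassage_add_le (hd : HasUnitDrift d) (t u : ℝ≥0) :
    firstPassage d (t + u) ≤ firstPassage d t + u := by
  rw [← tsub_le_iff_right]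
  refine le_csInf ⟨t, hd.le_self t⟩ fun s hs ↦ ?_
  rw [tsub_le_iff_right]
  refine firstPassage_le_of_le ?_
  have h := hd.add_le s u
  have hs' : (t : ℝ) ≤ d s := hs
  push_cast
  linarith

lemma lipschitzWith_firstPassage (hd : HasUnitDrift d) : LipschitzWith 1 (firstPassage d) := by
  have key : ∀ t r : ℝ≥0, t ≤ r → dist (firstPassage d t) (firstPassage d r) ≤ dist t r := by
    intro t r htr
    have h1 := hd.monotone_firstPassage htr
    have h2 := hd.firstPassage_add_le t (r - t)
    rw [add_tsub_cancel_of_le htr] at h2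
    have h2' : (firstPassage d r : ℝ) ≤ firstPassage d t + (r - t) := by
      have := NNReal.coe_le_coe.2 h2
      rwa [NNReal.coe_add, NNReal.coe_sub htr] at this
    rw [NNReal.dist_eq, NNReal.dist_eq, abs_sub_comm, abs_sub_comm (t : ℝ),
      abs_of_nonneg (sub_nonneg.2 (NNReal.coe_le_coe.2 h1)),
      abs_of_nonneg (sub_nonneg.2 (NNReal.coe_le_coe.2 htr))]
    linarith
  refine LipschitzWith.of_dist_le_mul fun t r ↦ ?_
  rw [NNReal.coe_one, one_mul]
  rcases le_total t r with h | h
  · exact key t r h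
  · rw [dist_comm, dist_comm t]
    exact key r t h

lemma gridFirstPassage_eq (hd : HasUnitDrift d) (t : ℝ≥0) :
    gridFirstPassage t d = firstPassage d t := by
  refine le_antisymm (le_csInf ⟨t, hd.le_self t⟩ fun s hs ↦ ?_) (le_ciInf fun p ↦ ?_)
  · refine ge_of_tendsto' ((tendsto_gridAbove s).mono_right nhdsWithin_le_nhds) fun n ↦ ?_
    have hmem : (t : ℝ) ≤ d (gridAbove n s) :=
      le_trans hs (hd.strictMono.monotone (le_gridAbove n s))
    refine (ciInf_le (OrderBot.bddBelow _) (⌊(n + 1 : ℝ≥0) * s⌋₊ + 1, n)).trans ?_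
    rw [gridAbove] at hmem ⊢
    rw [if_pos hmem]
  · split_ifs with h
    · exact firstPassage_le_of_le h
    · exact hd.firstPassage_le_self t

lemma integral_indicator_exp (hd : HasUnitDrift d) (a : ℝ) (t : ℝ≥0) :
    ∫ s in Set.Ioi (0 : ℝ), (if d s.toNNReal < t then a * Real.exp (-a * s) else 0)
      = 1 - Real.exp (-a * firstPassage d t) := by
  have hL : (0 : ℝ) ≤ firstPassage d t := NNReal.coe_nonneg _
  have hae : ∀ᵐ s ∂(volume.restrict (Set.Ioi (0 : ℝ))),
      (if d s.toNNReal < t then a * Real.exp (-a * s) else 0)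
        = (Set.Ioc (0 : ℝ) (firstPassage d t)).indicator (fun s ↦ a * Real.exp (-a * s)) s := by
    have hne : ∀ᵐ s ∂(volume.restrict (Set.Ioi (0 : ℝ))), s ≠ (firstPassage d t : ℝ) :=
      ae_restrict_of_ae (Measure.ae_ne volume _)
    filter_upwards [ae_restrict_mem measurableSet_Ioi, hne] with s hs hsne
    have hs0 : (0 : ℝ) ≤ s := le_of_lt hs
    by_cases h : d s.toNNReal < t
    · have := hd.le_firstPassage h
      rw [Real.toNNReal_le_iff_le_coe] at this
      rw [if_pos h, Set.indicator_of_mem (Set.mem_Ioc.2 ⟨hs, this⟩)]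
    · rw [if_neg h, Set.indicator_of_notMem]
      rintro ⟨-, hle⟩
      refine h (lt_of_lt_firstPassage ?_)
      rw [Real.toNNReal_lt_iff_lt_coe hs0]
      exact lt_of_le_of_ne hle hsne
  rw [integral_congr_ae hae, setIntegral_indicator measurableSet_Ioc,
    Set.inter_eq_right.2 Set.Ioc_subset_Ioi_self, ← intervalIntegral.integral_of_le hL]
  have hder : ∀ x ∈ Set.uIcc (0 : ℝ) (firstPassage d t),
      HasDerivAt (fun s ↦ -Real.exp (-a * s)) (a * Real.exp (-a * x)) x := by
    intro x _
    have := (((hasDerivAt_id x).const_mul (-a)).exp).neg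
    refine this.congr_deriv ?_
    simp
    ring
  rw [intervalIntegral.integral_eq_sub_of_hasDerivAt hder
    ((by fun_prop : Continuous fun x ↦ a * Real.exp (-a * x)).intervalIntegrable _ _)]
  simp
  ring

/-- The Laplace transform of the first passage times in terms of the path itself. -/
lemma laplace_firstPassage (hd : HasUnitDrift d) {a μ : ℝ} (ha : 0 ≤ a) (hμ : 0 < μ) :
    ∫ t in Set.Ioi (0 : ℝ), Real.exp (-μ * t) * Real.exp (-a * firstPassage d t.toNNReal)
      = μ⁻¹ - μ⁻¹ * ∫ s in Set.Ioi (0 : ℝ), a * Real.exp (-a * s) * Real.exp (-μ * d s.toNNReal) := by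
  have hdm : Measurable fun s : ℝ ↦ d s.toNNReal :=
    hd.strictMono.monotone.measurable.comp measurable_real_toNNReal
  have hia : IntegrableOn (fun s : ℝ ↦ a * Real.exp (-a * s)) (Set.Ioi 0) :=
    integrableOn_mul_exp_neg_mul ha
  have hiμ : IntegrableOn (fun t : ℝ ↦ Real.exp (-μ * t)) (Set.Ioi 0) :=
    integrableOn_exp_mul_Ioi (neg_neg_of_pos hμ) 0
  -- Integrating this kernel over `s` first produces the first passage time, over `t` first the path
  -- itself; Fubini equates the two.
  set K : ℝ → ℝ → ℝ := fun t s ↦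
    if d s.toNNReal < t then Real.exp (-μ * t) * (a * Real.exp (-a * s)) else 0 with hK
  have hKint : Integrable (Function.uncurry K)
      ((volume.restrict (Set.Ioi 0)).prod (volume.restrict (Set.Ioi 0))) := by
    refine (Integrable.mul_prod hiμ hia).mono' ?_ (ae_of_all _ fun p ↦ ?_)
    · refine (Measurable.ite (measurableSet_lt (hdm.comp measurable_snd) measurable_fst)
        ?_ measurable_const).aestronglyMeasurable
      fun_prop
    · simp only [Function.uncurry, hK]
      split_ifs
      · rw [Real.norm_of_nonneg (by positivity)]
      · simpa using by positivity
  have hinner : ∀ t : ℝ, 0 < t → ∫ s in Set.Ioi (0 : ℝ), K t s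
      = Real.exp (-μ * t) - Real.exp (-μ * t) * Real.exp (-a * firstPassage d t.toNNReal) := by
    intro t ht
    have := hd.integral_indicator_exp a t.toNNReal
    rw [Real.coe_toNNReal t ht.le] at this
    rw [← mul_one_sub, ← this, ← integral_const_mul]
    refine integral_congr_ae (ae_of_all _ fun s ↦ ?_)
    simp [hK]
  have houter : ∀ s : ℝ, ∫ t in Set.Ioi (0 : ℝ), K t s
      = μ⁻¹ * (a * Real.exp (-a * s) * Real.exp (-μ * d s.toNNReal)) := by
    intro s
    have hd0 : 0 ≤ d s.toNNReal := (NNReal.coe_nonneg _).trans (hd.le_self _)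
    have : ∀ t, K t s = (Set.Ioi (d s.toNNReal)).indicator
        (fun t ↦ Real.exp (-μ * t) * (a * Real.exp (-a * s))) t := by
      intro t
      simp [hK, Set.indicator]
    simp_rw [this]
    rw [setIntegral_indicator measurableSet_Ioi, Set.inter_eq_right.2 (Set.Ioi_subset_Ioi hd0),
      integral_mul_const, integral_exp_mul_Ioi (neg_neg_of_pos hμ)]
    field_simp
  have hswap := integral_integral_swap hKint
  simp_rw [houter] at hswap
  rw [setIntegral_congr_fun measurableSet_Ioi (fun t ht ↦ hinner t ht), integral_const_mul] at hswap
  have hLc : Continuous fun t : ℝ ↦ Real.exp (-μ * t) *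
      Real.exp (-a * firstPassage d t.toNNReal) := by
    have := hd.lipschitzWith_firstPassage.continuous
    fun_prop
  have hiL : IntegrableOn (fun t : ℝ ↦ Real.exp (-μ * t) *
      Real.exp (-a * firstPassage d t.toNNReal)) (Set.Ioi 0) := by
    refine hiμ.mono' hLc.aestronglyMeasurable (ae_of_all _ fun t ↦ ?_)
    rw [Real.norm_of_nonneg (by positivity)]
    refine mul_le_of_le_one_right (Real.exp_pos _).le (Real.exp_le_one_iff.2 ?_)
    rw [neg_mul]
    exact neg_nonpos.2 (by positivity)
  rw [integral_sub hiμ hiL, integral_exp_mul_Ioi (neg_neg_of_pos hμ)] at hswap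
  simp only [mul_zero, Real.exp_zero, neg_div_neg_eq, one_div] at hswap
  linarith

end HasUnitDrift

end FirstPassage

/-! ### The inverse of the drifted subordinator -/

section Subordinator

variable {Ω : Type*} [MeasurableSpace Ω] {P : Measure Ω} {lam : ℝ≥0} {ν : ℝ} {H : ℝ≥0 → Ω → ℝ}

lemma inverseProcess_eq_firstPassage {Ω : Type*} (lam : ℝ≥0) (H : ℝ≥0 → Ω → ℝ) (t : ℝ≥0) (ω : Ω) :
    inverseProcess lam H t ω = firstPassage (fun s ↦ driftedProcess lam H s ω) t := rfl

namespace IsStableSubordinator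

lemma ae_hasUnitDrift (hH : IsStableSubordinator ν H P) (lam : ℝ≥0) :
    ∀ᵐ ω ∂P, HasUnitDrift fun s ↦ driftedProcess lam H s ω := by
  filter_upwards [hH.zero, hH.monotone] with ω h0 hm
  refine ⟨by simp [driftedProcess, h0], fun s u ↦ ?_⟩
  have h : H s ω ≤ H (s + u) ω := hm le_self_add
  have := mul_le_mul_of_nonneg_left h (sq_nonneg (2 * lam : ℝ))
  simp only [driftedProcess]
  push_cast
  linarith

lemma measurable_driftedProcess (hH : IsStableSubordinator ν H P) (lam s : ℝ≥0) :
    Measurable (driftedProcess lam H s) :=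
  ((hH.measurable s).const_mul _).const_add _

lemma ae_gridFirstPassage_eq (hH : IsStableSubordinator ν H P) (lam t : ℝ≥0) :
    (fun ω ↦ gridFirstPassage t fun s ↦ driftedProcess lam H s ω)
      =ᵐ[P] inverseProcess lam H t := by
  filter_upwards [hH.ae_hasUnitDrift lam] with ω hω using hω.gridFirstPassage_eq t

lemma aemeasurable_inverseProcess (hH : IsStableSubordinator ν H P) (lam t : ℝ≥0) :
    AEMeasurable (inverseProcess lam H t) P :=
  ((measurable_gridFirstPassage t).comp
    (measurable_pi_lambda _ (hH.measurable_driftedProcess lam))).aemeasurable.congr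
    (hH.ae_gridFirstPassage_eq lam t)

/-- The inverse is almost surely `gridFirstPassage`, a product-measurable function of the path of
`H`. -/
lemma indepFun_inverseProcess (hH : IsStableSubordinator ν H P) {B : ℝ≥0 → Ω → ℝ}
    (hBH : IndepFun (fun ω t ↦ B t ω) (fun ω t ↦ H t ω) P) (lam s t : ℝ≥0) :
    IndepFun (B s) (inverseProcess lam H t) P := by
  have hm : Measurable fun h : ℝ≥0 → ℝ ↦
      gridFirstPassage t fun s ↦ (s + (2 * lam) ^ 2 * h s : ℝ) :=
    (measurable_gridFirstPassage t).comp (measurable_pi_lambda _ fun s ↦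
      ((measurable_pi_apply s).const_mul _).const_add _)
  exact (hBH.comp (measurable_pi_apply s) hm).congr (ae_of_all _ fun _ ↦ rfl)
    (hH.ae_gridFirstPassage_eq lam t)

/-- Evaluate the Laplace transform of `H` at `μ (2 lam)²`, whose square root is `2 lam √μ`. -/
lemma integral_exp_driftedProcess (hH : IsStableSubordinator (1 / 2) H P) (hlam : 0 < lam)
    (s : ℝ≥0) {μ : ℝ} (hμ : 0 < μ) :
    ∫ ω, Real.exp (-μ * driftedProcess lam H s ω) ∂P
      = Real.exp (-(μ + 2 * lam * √μ) * s) := by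
  have h := hH.laplace s (μ * (2 * lam) ^ 2) (by positivity)
  rw [← Real.sqrt_eq_rpow, Real.sqrt_mul hμ.le, Real.sqrt_sq (by positivity)] at h
  have : ∀ ω, Real.exp (-μ * driftedProcess lam H s ω)
      = Real.exp (-μ * s) * Real.exp (-(μ * (2 * lam) ^ 2) * H s ω) := by
    intro ω
    rw [← Real.exp_add, driftedProcess]
    ring_nf
  simp_rw [this]
  rw [integral_const_mul, h, ← Real.exp_add]
  ring_nf

variable [IsProbabilityMeasure P]

lemma continuous_integral_exp_inverseProcess (hH : IsStableSubordinator ν H P) (lam : ℝ≥0)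
    {a : ℝ} (ha : 0 ≤ a) :
    Continuous fun t : ℝ≥0 ↦ ∫ ω, Real.exp (-a * inverseProcess lam H t ω) ∂P := by
  refine continuous_of_dominated (bound := fun _ ↦ 1) (fun t ↦ ?_) (fun t ↦ ae_of_all _ fun ω ↦ ?_)
    (integrable_const _) ?_
  · exact ((by fun_prop : Measurable fun x : ℝ≥0 ↦ Real.exp (-a * x)).comp_aemeasurable
      (hH.aemeasurable_inverseProcess lam t)).aestronglyMeasurable
  · rw [Real.norm_of_nonneg (Real.exp_pos _).le, Real.exp_le_one_iff, neg_mul]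
    exact neg_nonpos.2 (by positivity)
  · filter_upwards [hH.ae_hasUnitDrift lam] with ω hω
    have := hω.lipschitzWith_firstPassage.continuous
    simp only [inverseProcess_eq_firstPassage]
    fun_prop

/-- The Laplace transform in `t` of the Laplace transforms of the inverse process at time `t`. -/
lemma laplace_inverseProcess (hH : IsStableSubordinator (1 / 2) H P) (hlam : 0 < lam)
    {a μ : ℝ} (ha : 0 ≤ a) (hμ : 0 < μ) :
    ∫ t in Set.Ioi (0 : ℝ), Real.exp (-μ * t) *
        ∫ ω, Real.exp (-a * inverseProcess lam H t.toNNReal ω) ∂P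
      = μ⁻¹ * ((μ + 2 * lam * √μ) / (μ + 2 * lam * √μ + a)) := by
  have hia : IntegrableOn (fun s : ℝ ↦ a * Real.exp (-a * s)) (Set.Ioi 0) :=
    integrableOn_mul_exp_neg_mul ha
  have hiμ : IntegrableOn (fun t : ℝ ↦ Real.exp (-μ * t)) (Set.Ioi 0) :=
    integrableOn_exp_mul_Ioi (neg_neg_of_pos hμ) 0
  have hone : Integrable (fun _ : Ω ↦ (1 : ℝ)) P := integrable_const _
  have hLint : Integrable (Function.uncurry fun (t : ℝ) ω ↦ Real.exp (-μ * t) *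
      Real.exp (-a * inverseProcess lam H t.toNNReal ω))
      ((volume.restrict (Set.Ioi 0)).prod P) := by
    have hm := aemeasurable_uncurry_toNNReal (P := P) (Y := inverseProcess lam H)
      (hH.aemeasurable_inverseProcess lam) (by
        filter_upwards [hH.ae_hasUnitDrift lam] with ω hω s
        exact hω.lipschitzWith_firstPassage.continuous.continuousWithinAt)
      (volume.restrict (Set.Ioi 0))
    refine (Integrable.mul_prod hiμ hone).mono' ?_ (ae_of_all _ fun p ↦ ?_)
    · exact ((by fun_prop : Measurable fun p : ℝ × Ω ↦ Real.exp (-μ * p.1)).aemeasurable.mul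
        ((by fun_prop : Measurable fun x : ℝ≥0 ↦ Real.exp (-a * x)).comp_aemeasurable
          hm)).aestronglyMeasurable
    · simp only [Function.uncurry]
      rw [Real.norm_of_nonneg (by positivity)]
      gcongr
      rw [Real.exp_le_one_iff, neg_mul]
      exact neg_nonpos.2 (by positivity)
  have hdnn : ∀ᵐ ω ∂P, ∀ s, 0 ≤ driftedProcess lam H s ω := by
    filter_upwards [hH.ae_hasUnitDrift lam] with ω hω s
    exact (NNReal.coe_nonneg _).trans (hω.le_self s)
  have hDint : Integrable (Function.uncurry fun (s : ℝ) ω ↦ a * Real.exp (-a * s) *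
      Real.exp (-μ * driftedProcess lam H s.toNNReal ω))
      ((volume.restrict (Set.Ioi 0)).prod P) := by
    have hm := aemeasurable_uncurry_toNNReal (P := P) (Y := driftedProcess lam H)
      (fun s ↦ (hH.measurable_driftedProcess lam s).aemeasurable) (by
        filter_upwards [hH.right_continuous] with ω hω s
        exact NNReal.continuous_coe.continuousWithinAt.add ((hω s).const_mul _))
      (volume.restrict (Set.Ioi 0))
    refine (Integrable.mul_prod hia hone).mono' ?_ ?_
    · exact ((by fun_prop : Measurable fun p : ℝ × Ω ↦ a * Real.exp (-a * p.1)).aemeasurable.mul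
        ((by fun_prop : Measurable fun x : ℝ ↦ Real.exp (-μ * x)).comp_aemeasurable
          hm)).aestronglyMeasurable
    · filter_upwards [Measure.quasiMeasurePreserving_snd.ae hdnn] with p hp
      simp only [Function.uncurry]
      rw [Real.norm_of_nonneg (by positivity)]
      gcongr
      rw [Real.exp_le_one_iff, neg_mul]
      exact neg_nonpos.2 (mul_nonneg hμ.le (hp _))
  have hpath : (fun ω ↦ ∫ t in Set.Ioi (0 : ℝ), Real.exp (-μ * t) *
      Real.exp (-a * inverseProcess lam H t.toNNReal ω)) =ᵐ[P] fun ω ↦ μ⁻¹ - μ⁻¹ *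
      ∫ s in Set.Ioi (0 : ℝ), a * Real.exp (-a * s) *
        Real.exp (-μ * driftedProcess lam H s.toNNReal ω) := by
    filter_upwards [hH.ae_hasUnitDrift lam] with ω hω using hω.laplace_firstPassage ha hμ
  have hDi : Integrable (fun ω ↦ ∫ s in Set.Ioi (0 : ℝ), a * Real.exp (-a * s) *
      Real.exp (-μ * driftedProcess lam H s.toNNReal ω)) P := hDint.integral_prod_right
  simp_rw [← integral_const_mul]
  -- Bring the expectation outside, apply the pathwise identity, and bring it back inside, where
  -- only the mean of `exp (-μ d s)` is needed.
  rw [integral_integral_swap hLint, integral_congr_ae hpath,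
    integral_sub (integrable_const _) (hDi.const_mul _),
    integral_const_mul, ← integral_integral_swap hDint]
  simp_rw [integral_const_mul, hH.integral_exp_driftedProcess hlam _ hμ]
  have hpos : 0 < μ + 2 * lam * √μ + a := by positivity
  have hfin : ∫ s in Set.Ioi (0 : ℝ), a * Real.exp (-a * s) *
      Real.exp (-(μ + 2 * lam * √μ) * s.toNNReal) = a / (μ + 2 * lam * √μ + a) := by
    rw [setIntegral_congr_fun (g := fun s ↦ a * Real.exp (-(μ + 2 * lam * √μ + a) * s))
      measurableSet_Ioi (fun s hs ↦ ?_), integral_const_mul,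
      integral_exp_mul_Ioi (neg_neg_of_pos hpos)]
    · rw [mul_zero, Real.exp_zero, neg_div_neg_eq, mul_one_div]
    · simp only
      rw [Real.coe_toNNReal s (le_of_lt hs), mul_assoc, ← Real.exp_add]
      ring_nf
  rw [hfin]
  simp
  field_simp
  ring

end IsStableSubordinator

end Subordinator

/-! ### Brownian motion at an exponential time -/

section Brownian

lemma integral_withDensity_ofReal {α : Type*} [MeasurableSpace α] {ρ : Measure α} {r : α → ℝ}
    (hr : Measurable r) (h0 : ∀ x, 0 ≤ r x) (g : α → ℂ) :
    ∫ x, g x ∂(ρ.withDensity fun x ↦ ENNReal.ofReal (r x)) = ∫ x, (r x : ℂ) * g x ∂ρ := by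
  rw [show (fun x ↦ ENNReal.ofReal (r x)) = fun x ↦ (((r x).toNNReal : ℝ≥0) : ℝ≥0∞) from rfl,
    integral_withDensity_eq_integral_smul hr.real_toNNReal]
  refine integral_congr_ae (ae_of_all _ fun x ↦ ?_)
  simp only [NNReal.smul_def, Real.coe_toNNReal _ (h0 x), Complex.real_smul]

/-- The measure `exp (-μ t) dt` on `(0, ∞)`. -/
noncomputable def expMeasureIoi (μ : ℝ) : Measure ℝ :=
  (volume.restrict (Set.Ioi 0)).withDensity fun t ↦ ENNReal.ofReal (Real.exp (-μ * t))

/-- The measure with density `exp (-p |x|) / (2 p)`. -/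
noncomputable def laplaceMeasure (p : ℝ) : Measure ℝ :=
  volume.withDensity fun x ↦ ENNReal.ofReal ((2 * p)⁻¹ * Real.exp (-p * |x|))

lemma isFiniteMeasure_expMeasureIoi {μ : ℝ} (hμ : 0 < μ) : IsFiniteMeasure (expMeasureIoi μ) :=
  isFiniteMeasure_withDensity_ofReal (integrableOn_exp_mul_Ioi (neg_neg_of_pos hμ) 0).2

lemma integral_expMeasureIoi (μ : ℝ) (g : ℝ → ℂ) :
    ∫ t, g t ∂(expMeasureIoi μ) = ∫ t in Set.Ioi (0 : ℝ), Complex.exp (-μ * t) * g t := by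
  rw [expMeasureIoi, integral_withDensity_ofReal (by fun_prop) fun _ ↦ (Real.exp_pos _).le]
  push_cast
  rfl

lemma integrableOn_exp_neg_mul_abs_mul_exp_Ioi {p : ℝ} (hp : 0 < p) (ξ : ℝ) :
    IntegrableOn (fun x : ℝ ↦ Complex.exp ((-p + ξ * Complex.I) * x)) (Set.Ioi 0) :=
  integrableOn_exp_mul_complex_Ioi (by simpa using hp) 0

lemma integrableOn_exp_neg_mul_abs_mul_exp_Iic {p : ℝ} (hp : 0 < p) (ξ : ℝ) :
    IntegrableOn (fun x : ℝ ↦ Complex.exp ((p + ξ * Complex.I) * x)) (Set.Iic 0) :=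
  integrableOn_exp_mul_complex_Iic (by simpa using hp) 0

lemma exp_neg_mul_abs_mul_exp_of_nonneg {p ξ x : ℝ} (hx : 0 ≤ x) :
    (Real.exp (-p * |x|) : ℂ) * Complex.exp (ξ * x * Complex.I)
      = Complex.exp ((-p + ξ * Complex.I) * x) := by
  rw [abs_of_nonneg hx]
  push_cast
  rw [← Complex.exp_add]
  ring_nf

lemma exp_neg_mul_abs_mul_exp_of_nonpos {p ξ x : ℝ} (hx : x ≤ 0) :
    (Real.exp (-p * |x|) : ℂ) * Complex.exp (ξ * x * Complex.I)
      = Complex.exp ((p + ξ * Complex.I) * x) := by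
  rw [abs_of_nonpos hx]
  push_cast
  rw [← Complex.exp_add]
  ring_nf

lemma integral_exp_neg_mul_abs_mul_exp {p : ℝ} (hp : 0 < p) (ξ : ℝ) :
    ∫ x : ℝ, (Real.exp (-p * |x|) : ℂ) * Complex.exp (ξ * x * Complex.I)
      = 2 * p / (p ^ 2 + ξ ^ 2) := by
  have h1 : IntegrableOn (fun x : ℝ ↦ (Real.exp (-p * |x|) : ℂ) *
      Complex.exp (ξ * x * Complex.I)) (Set.Ioi 0) :=
    (integrableOn_exp_neg_mul_abs_mul_exp_Ioi hp ξ).congr_fun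
      (fun x hx ↦ (exp_neg_mul_abs_mul_exp_of_nonneg (le_of_lt hx)).symm) measurableSet_Ioi
  have h2 : IntegrableOn (fun x : ℝ ↦ (Real.exp (-p * |x|) : ℂ) *
      Complex.exp (ξ * x * Complex.I)) (Set.Iic 0) :=
    (integrableOn_exp_neg_mul_abs_mul_exp_Iic hp ξ).congr_fun
      (fun x hx ↦ (exp_neg_mul_abs_mul_exp_of_nonpos hx).symm) measurableSet_Iic
  rw [← intervalIntegral.integral_Iic_add_Ioi h2 h1,
    setIntegral_congr_fun measurableSet_Iic fun x hx ↦ exp_neg_mul_abs_mul_exp_of_nonpos hx,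
    setIntegral_congr_fun measurableSet_Ioi
      fun x hx ↦ exp_neg_mul_abs_mul_exp_of_nonneg (le_of_lt hx),
    integral_exp_mul_complex_Ioi (by simpa using hp),
    integral_exp_mul_complex_Iic (by simpa using hp)]
  have hn1 : (p : ℂ) + ξ * Complex.I ≠ 0 := fun h ↦ hp.ne' (by simpa using congrArg Complex.re h)
  have hn2 : -(p : ℂ) + ξ * Complex.I ≠ 0 := fun h ↦ hp.ne' (by simpa using congrArg Complex.re h)
  have hn3 : (p : ℂ) ^ 2 + ξ ^ 2 ≠ 0 := by
    have : p ^ 2 + ξ ^ 2 ≠ 0 := by positivity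
    exact_mod_cast this
  simp only [Complex.ofReal_zero, mul_zero, Complex.exp_zero]
  field_simp
  linear_combination (-2 * (p : ℂ) * ξ ^ 2) * Complex.I_sq

lemma integrable_exp_neg_mul_abs {p : ℝ} (hp : 0 < p) :
    Integrable fun x : ℝ ↦ Real.exp (-p * |x|) := by
  have h1 : IntegrableOn (fun x : ℝ ↦ Real.exp (-p * |x|)) (Set.Ioi 0) :=
    (integrableOn_exp_mul_Ioi (neg_neg_of_pos hp) 0).congr_fun
      (fun x hx ↦ by simp only [abs_of_pos (Set.mem_Ioi.1 hx)]) measurableSet_Ioi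
  have h2 : IntegrableOn (fun x : ℝ ↦ Real.exp (-p * |x|)) (Set.Iic 0) :=
    (integrableOn_exp_mul_Iic hp 0).congr_fun
      (fun x hx ↦ by simp only [abs_of_nonpos (Set.mem_Iic.1 hx), neg_mul_neg]) measurableSet_Iic
  have := h2.union h1
  rwa [Set.Iic_union_Ioi, integrableOn_univ] at this

lemma isFiniteMeasure_laplaceMeasure {p : ℝ} (hp : 0 < p) : IsFiniteMeasure (laplaceMeasure p) :=
  isFiniteMeasure_withDensity_ofReal ((integrable_exp_neg_mul_abs hp).const_mul _).2

lemma integral_laplaceMeasure {p : ℝ} (hp : 0 < p) (g : ℝ → ℂ) :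
    ∫ x, g x ∂(laplaceMeasure p) = (2 * p)⁻¹ * ∫ x : ℝ, (Real.exp (-p * |x|) : ℂ) * g x := by
  rw [laplaceMeasure, integral_withDensity_ofReal (by fun_prop) fun _ ↦ by positivity,
    ← integral_const_mul]
  push_cast
  simp_rw [mul_assoc]

/-- For `p = √μ` this is `∫ exp (-μ t) exp (-t ξ²) dt` over `(0, ∞)`. Both measures are left
unnormalised, with mass `1 / μ`. -/
lemma charFun_laplaceMeasure {p : ℝ} (hp : 0 < p) (ξ : ℝ) :
    charFun (laplaceMeasure p) ξ = 1 / (p ^ 2 + ξ ^ 2) := by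
  rw [charFun_apply_real, integral_laplaceMeasure hp, integral_exp_neg_mul_abs_mul_exp hp]
  have hp0 : (p : ℂ) ≠ 0 := by exact_mod_cast hp.ne'
  push_cast
  field_simp

lemma integral_comp_abs_complex {f : ℝ → ℂ} (hf : Integrable fun x ↦ f |x|) :
    ∫ x : ℝ, f |x| = 2 * ∫ x in Set.Ioi (0 : ℝ), f x := by
  rw [← intervalIntegral.integral_Iic_add_Ioi (hf.integrableOn (s := Set.Iic 0)) hf.integrableOn,
    setIntegral_congr_fun (g := f) measurableSet_Ioi
      fun x hx ↦ by simp only [abs_of_pos (Set.mem_Ioi.1 hx)],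
    setIntegral_congr_fun (g := fun x ↦ f (-x)) measurableSet_Iic
      fun x hx ↦ by simp only [abs_of_nonpos (Set.mem_Iic.1 hx)],
    integral_comp_neg_Iic, neg_zero, two_mul]

variable {Ω : Type*} [MeasurableSpace Ω] {P : Measure Ω} {B : ℝ≥0 → Ω → ℝ}

namespace IsBrownianSpeedTwo

lemma ae_continuous (hB : IsBrownianSpeedTwo B P) : ∀ᵐ ω ∂P, Continuous fun t ↦ B t ω := by
  filter_upwards [hB.isBrownianReal.cont] with ω hω
  have : (fun t ↦ B t ω) = fun t ↦ √2 * ((√2)⁻¹ * B t ω) := by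
    funext t
    field_simp
  rw [this]
  exact hω.const_mul _

lemma fourierLaw_eq (hB : IsBrownianSpeedTwo B P) (s : ℝ≥0) (ξ : ℝ) :
    fourierLaw (B s) P ξ = Complex.exp (-(s * ξ ^ 2)) := by
  have h := (hB.isBrownianReal.hasLaw_eval s).integral_comp
    (f := fun x : ℝ ↦ Complex.exp ((√2 * ξ : ℝ) * x * Complex.I))
    (by fun_prop : Continuous _).aestronglyMeasurable
  rw [← charFun_apply_real, charFun_gaussianReal] at h
  have h2 : ((√2 * ξ : ℝ) : ℂ) ^ 2 = 2 * ξ ^ 2 := by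
    rw [← Complex.ofReal_pow, mul_pow, Real.sq_sqrt (by norm_num)]
    push_cast
    rfl
  rw [h2] at h
  rw [fourierLaw]
  convert h using 1
  · refine integral_congr_ae (ae_of_all _ fun ω ↦ ?_)
    simp only [Function.comp]
    congr 1
    have h3 : (√2 : ℂ) ≠ 0 := by
      exact_mod_cast (Real.sqrt_pos.2 two_pos).ne'
    push_cast
    field_simp
  · congr 1
    push_cast
    ring

lemma aemeasurable_uncurry [SFinite P] (hB : IsBrownianSpeedTwo B P) (ν : Measure ℝ) :
    AEMeasurable (fun p : ℝ × Ω ↦ B p.1.toNNReal p.2) (ν.prod P) :=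
  aemeasurable_uncurry_toNNReal (fun s ↦ (hB.measurable s).aemeasurable)
    (by filter_upwards [hB.ae_continuous] with ω hω s using hω.continuousWithinAt) ν

/-- Brownian motion, stopped at an independent exponential time, has a Laplace distribution. -/
lemma map_expMeasureIoi_prod [IsProbabilityMeasure P] (hB : IsBrownianSpeedTwo B P) {μ : ℝ}
    (hμ : 0 < μ) :
    ((expMeasureIoi μ).prod P).map (fun p ↦ B p.1.toNNReal p.2) = laplaceMeasure √μ := by
  have := isFiniteMeasure_expMeasureIoi hμ
  have := isFiniteMeasure_laplaceMeasure (Real.sqrt_pos.2 hμ)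
  have hm := hB.aemeasurable_uncurry (expMeasureIoi μ)
  refine Measure.ext_of_charFun (funext fun ξ ↦ ?_)
  have hint : Integrable (fun p : ℝ × Ω ↦ Complex.exp (ξ * B p.1.toNNReal p.2 * Complex.I))
      ((expMeasureIoi μ).prod P) := by
    refine (integrable_const (1 : ℝ)).mono' ((by fun_prop : Measurable fun x : ℝ ↦
      Complex.exp (ξ * x * Complex.I)).comp_aemeasurable hm).aestronglyMeasurable
      (ae_of_all _ fun p ↦ ?_)
    rw [← Complex.ofReal_mul, Complex.norm_exp_ofReal_mul_I]
  rw [charFun_laplaceMeasure (Real.sqrt_pos.2 hμ), charFun_apply_real, integral_map hm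
    (by fun_prop : Continuous fun x : ℝ ↦ Complex.exp (ξ * x * Complex.I)).aestronglyMeasurable,
    integral_prod _ hint, integral_expMeasureIoi]
  have hpos : 0 < μ + ξ ^ 2 := by positivity
  rw [setIntegral_congr_fun (g := fun t : ℝ ↦ Complex.exp (-(μ + ξ ^ 2) * t)) measurableSet_Ioi
    fun t ht ↦ ?_, integral_exp_mul_complex_Ioi]
  · rw [← Complex.ofReal_pow √μ, Real.sq_sqrt hμ.le]
    simp only [Complex.ofReal_zero, mul_zero, Complex.exp_zero, neg_div_neg_eq]
  · have : (-((μ : ℂ) + (ξ : ℂ) ^ 2)).re = -(μ + ξ ^ 2) := by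
      rw [← Complex.ofReal_pow, ← Complex.ofReal_add, ← Complex.ofReal_neg, Complex.ofReal_re]
    rw [this]
    exact neg_neg_of_pos hpos
  · have h := hB.fourierLaw_eq t.toNNReal ξ
    rw [fourierLaw, Real.coe_toNNReal t (le_of_lt ht)] at h
    have h' : ∫ ω, Complex.exp (ξ * B t.toNNReal ω * Complex.I) ∂P
        = Complex.exp (-(t * ξ ^ 2)) := by
      rw [← h]
      refine integral_congr_ae (ae_of_all _ fun ω ↦ ?_)
      simp only
      ring_nf
    simp only
    rw [h', ← Complex.exp_add]
    ring_nf

/-- By Fubini the left side integrates `g |x|` against `laplaceMeasure √μ`; the density is even, so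
folding turns `1 / (2 √μ)` into `1 / √μ`. -/
lemma laplace_integral_abs [IsProbabilityMeasure P] (hB : IsBrownianSpeedTwo B P) {μ : ℝ}
    (hμ : 0 < μ) {g : ℝ → ℂ} (hg : Continuous g) (hb : ∀ x, ‖g x‖ ≤ 1) :
    ∫ t in Set.Ioi (0 : ℝ), Complex.exp (-μ * t) * ∫ ω, g |B t.toNNReal ω| ∂P
      = (√μ : ℂ)⁻¹ * ∫ x in Set.Ioi (0 : ℝ), Complex.exp (-√μ * x) * g x := by
  have := isFiniteMeasure_expMeasureIoi hμ
  have hm := hB.aemeasurable_uncurry (expMeasureIoi μ)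
  have hga : Continuous fun x : ℝ ↦ g |x| := hg.comp continuous_abs
  have hint : Integrable (fun p : ℝ × Ω ↦ g |B p.1.toNNReal p.2|) ((expMeasureIoi μ).prod P) :=
    (integrable_const (1 : ℝ)).mono'
      (hga.measurable.comp_aemeasurable hm).aestronglyMeasurable (ae_of_all _ fun p ↦ hb _)
  have hiabs : Integrable fun x : ℝ ↦ (Real.exp (-√μ * |x|) : ℂ) * g |x| := by
    refine (integrable_exp_neg_mul_abs (Real.sqrt_pos.2 hμ)).mono'
      ((by fun_prop : Continuous fun x : ℝ ↦ (Real.exp (-√μ * |x|) : ℂ)).mul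
        hga).aestronglyMeasurable (ae_of_all _ fun x ↦ ?_)
    rw [norm_mul, Complex.norm_real, Real.norm_of_nonneg (Real.exp_pos _).le]
    exact mul_le_of_le_one_right (Real.exp_pos _).le (hb _)
  rw [← integral_expMeasureIoi, ← integral_prod _ hint,
    ← integral_map (f := fun x ↦ g |x|) hm hga.aestronglyMeasurable, hB.map_expMeasureIoi_prod hμ,
    integral_laplaceMeasure (Real.sqrt_pos.2 hμ),
    integral_comp_abs_complex (f := fun x : ℝ ↦ (Real.exp (-√μ * x) : ℂ) * g x) hiabs]
  have hp0 : (√μ : ℂ) ≠ 0 := by exact_mod_cast (Real.sqrt_pos.2 hμ).ne'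
  push_cast
  field_simp

end IsBrownianSpeedTwo

end Brownian

/-! ### The two subordinated processes -/

section Subordinated

variable {Ω : Type*} [MeasurableSpace Ω] {P : Measure Ω} {c lam : ℝ≥0}

lemma aemeasurable_timeChangedBrownian {B H : ℝ≥0 → Ω → ℝ}
    (hB : IsBrownianSpeedTwo B P) {ν : ℝ}
    (hH : IsStableSubordinator ν H P) (c lam t : ℝ≥0) :
    AEMeasurable (fun ω ↦ B (c ^ 2 * inverseProcess lam H t ω) ω) P :=
  aemeasurable_randomTime (fun s ↦ (hB.measurable s).aemeasurable)
    (by filter_upwards [hB.ae_continuous] with ω hω s using hω.continuousWithinAt)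
    ((hH.aemeasurable_inverseProcess lam t).const_mul _)

lemma aemeasurable_telegraphBrownian {T B' : ℝ≥0 → Ω → ℝ}
    (hT : IsTelegraphProcess c lam T P)
    (hB' : IsBrownianSpeedTwo B' P) (t : ℝ≥0) :
    AEMeasurable (fun ω ↦ T ‖B' t ω‖₊ ω) P :=
  aemeasurable_randomTime hT.aemeasurable
    (by filter_upwards [hT.ae_continuous] with ω hω s using hω.continuousWithinAt)
    (hB'.measurable t).nnnorm.aemeasurable

variable [IsProbabilityMeasure P]

lemma norm_fourierLaw_le (X : Ω → ℝ) (ξ : ℝ) : ‖fourierLaw X P ξ‖ ≤ 1 := by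
  simpa [fourierLaw] using norm_integral_le_of_norm_le_const (μ := P) (C := 1)
    (f := fun ω ↦ Complex.exp (Complex.I * ξ * X ω))
    (ae_of_all _ fun ω ↦ (norm_exp_I_mul_mul _ _).le)

/-- The Fourier transform of a continuous process at an independent random time. -/
lemma fourierLaw_randomTime {Y : ℝ≥0 → Ω → ℝ} (hY : ∀ s, AEMeasurable (Y s) P)
    (hc : ∀ᵐ ω ∂P, Continuous fun s ↦ Y s ω) {X : Ω → ℝ≥0} (hX : AEMeasurable X P)
    (hind : ∀ s, IndepFun (Y s) X P) (ξ : ℝ) :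
    fourierLaw (fun ω ↦ Y (X ω) ω) P ξ = ∫ ω, fourierLaw (Y (X ω)) P ξ ∂P := by
  have hem : Measurable fun x : ℝ ↦ Complex.exp (Complex.I * ξ * x) := by fun_prop
  refine integral_randomTime (Y := fun s ω ↦ Complex.exp (Complex.I * ξ * Y s ω))
    (fun s ↦ hem.comp_aemeasurable (hY s)) (fun s ω ↦ (norm_exp_I_mul_mul _ _).le) ?_ hX
    (fun s ↦ (hind s).comp hem measurable_id)
  filter_upwards [hc] with ω hω s
  exact (by fun_prop : Continuous fun s ↦ Complex.exp (Complex.I * ξ * Y s ω)).continuousWithinAt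

lemma identDistrib_of_fourierLaw_eq {Ω' : Type*} [MeasurableSpace Ω'] {P' : Measure Ω'}
    [IsProbabilityMeasure P'] {X : Ω → ℝ} {Y : Ω' → ℝ} (hX : AEMeasurable X P)
    (hY : AEMeasurable Y P') (h : ∀ ξ, fourierLaw X P ξ = fourierLaw Y P' ξ) :
    IdentDistrib X Y P P' := by
  refine ⟨hX, hY, ?_⟩
  have := Measure.isProbabilityMeasure_map hX
  have := Measure.isProbabilityMeasure_map hY
  refine Measure.ext_of_charFun (funext fun ξ ↦ ?_)
  have hcont : Continuous fun x : ℝ ↦ Complex.exp (ξ * x * Complex.I) := by fun_prop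
  rw [charFun_apply_real, charFun_apply_real, integral_map hX hcont.aestronglyMeasurable,
    integral_map hY hcont.aestronglyMeasurable]
  simpa only [fourierLaw, mul_comm Complex.I, mul_right_comm _ Complex.I] using h ξ

/-! ### Brownian motion at the inverse of the drifted subordinator -/

section TimeChangedBrownian

variable {B H : ℝ≥0 → Ω → ℝ}

lemma fourierLaw_timeChangedBrownian (hB : IsBrownianSpeedTwo B P) {ν : ℝ}
    (hH : IsStableSubordinator ν H P)
    (hBH : IndepFun (fun ω t ↦ B t ω) (fun ω t ↦ H t ω) P) (c lam t : ℝ≥0) (ξ : ℝ) :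
    fourierLaw (fun ω ↦ B (c ^ 2 * inverseProcess lam H t ω) ω) P ξ
      = (∫ ω, Real.exp (-(c ^ 2 * ξ ^ 2) * inverseProcess lam H t ω) ∂P : ℝ) := by
  rw [fourierLaw_randomTime (Y := B) (X := fun ω ↦ c ^ 2 * inverseProcess lam H t ω)
    (fun s ↦ (hB.measurable s).aemeasurable) hB.ae_continuous
    ((hH.aemeasurable_inverseProcess lam t).const_mul _)
    (fun s ↦ (hH.indepFun_inverseProcess hBH lam s t).comp measurable_id
      (measurable_const_mul (c ^ 2))), ← integral_complex_ofReal]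
  refine integral_congr_ae (ae_of_all _ fun ω ↦ ?_)
  simp only [hB.fourierLaw_eq]
  push_cast
  ring_nf

lemma fourierLaplace_timeChangedBrownian (hB : IsBrownianSpeedTwo B P)
    (hH : IsStableSubordinator (1 / 2) H P)
    (hBH : IndepFun (fun ω t ↦ B t ω) (fun ω t ↦ H t ω) P) (hlam : 0 < lam) (ξ : ℝ) {μ : ℝ}
    (hμ : 0 < μ) :
    fourierLaplace (fun t ω ↦ B (c ^ 2 * inverseProcess lam H t ω) ω) P ξ μ =
      (((1 + 2 * lam * μ ^ (-1 / 2 : ℝ)) / (μ + 2 * lam * √μ + c ^ 2 * ξ ^ 2) : ℝ) : ℂ) := by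
  -- The Gaussian transform at time `c² L` is `exp (-c² ξ² L)`, which fixes `a`.
  have h := hH.laplace_inverseProcess hlam (a := c ^ 2 * ξ ^ 2) (by positivity) hμ
  have hrpow : μ ^ (-1 / 2 : ℝ) = (√μ)⁻¹ := by
    rw [Real.sqrt_eq_rpow, ← Real.rpow_neg hμ.le]; norm_num
  have hs : 0 < √μ := Real.sqrt_pos.2 hμ
  have hval : μ⁻¹ * ((μ + 2 * lam * √μ) / (μ + 2 * lam * √μ + c ^ 2 * ξ ^ 2))
      = (1 + 2 * lam * μ ^ (-1 / 2 : ℝ)) / (μ + 2 * lam * √μ + c ^ 2 * ξ ^ 2) := by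
    rw [hrpow, ← mul_div_assoc]
    congr 1
    have : μ = √μ * √μ := (Real.mul_self_sqrt hμ.le).symm
    field_simp
    linear_combination (-2 * lam : ℝ) * this
  rw [← hval, ← h, fourierLaplace, ← integral_complex_ofReal]
  refine integral_congr_ae (ae_of_all _ fun t ↦ ?_)
  simp only [fourierLaw_timeChangedBrownian hB hH hBH]
  push_cast
  rfl

end TimeChangedBrownian

/-! ### The telegraph process at reflecting Brownian time -/

section TelegraphBrownian

variable {T B' : ℝ≥0 → Ω → ℝ}

lemma IsTelegraphProcess.continuous_fourierLaw (hT : IsTelegraphProcess c lam T P) (ξ : ℝ) :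
    Continuous fun s ↦ fourierLaw (T s) P ξ := by
  refine continuous_of_dominated (bound := fun _ ↦ 1) (fun s ↦ ?_)
    (fun s ↦ ae_of_all _ fun ω ↦ (norm_exp_I_mul_mul _ _).le) (integrable_const _) ?_
  · exact ((by fun_prop : Measurable fun x : ℝ ↦
      Complex.exp (Complex.I * ξ * x)).comp_aemeasurable (hT.aemeasurable s)).aestronglyMeasurable
  · filter_upwards [hT.ae_continuous] with ω hω
    fun_prop

lemma fourierLaw_telegraphBrownian (hT : IsTelegraphProcess c lam T P)
    (hB' : IsBrownianSpeedTwo B' P)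
    (hTB' : IndepFun (fun ω t ↦ T t ω) (fun ω t ↦ |B' t ω|) P) (t : ℝ≥0) (ξ : ℝ) :
    fourierLaw (fun ω ↦ T ‖B' t ω‖₊ ω) P ξ = ∫ ω, fourierLaw (T ‖B' t ω‖₊) P ξ ∂P := by
  refine fourierLaw_randomTime hT.aemeasurable hT.ae_continuous
    (hB'.measurable t).nnnorm.aemeasurable (fun s ↦ ?_) ξ
  -- Independence is assumed from `|B'|` only, so `‖B' t‖₊` is rewritten as a function of `|B' t|`.
  refine (hTB'.comp (measurable_pi_apply s)
    (measurable_real_toNNReal.comp (measurable_pi_apply t))).congr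
    (ae_of_all _ fun _ ↦ rfl) (ae_of_all _ fun ω ↦ ?_)
  exact NNReal.eq (by simp)

lemma fourierLaplace_telegraphBrownian (hT : IsTelegraphProcess c lam T P)
    (hB' : IsBrownianSpeedTwo B' P)
    (hTB' : IndepFun (fun ω t ↦ T t ω) (fun ω t ↦ |B' t ω|) P) (hc : 0 < c) (ξ : ℝ) {μ : ℝ}
    (hμ : 0 < μ) :
    fourierLaplace (fun t ω ↦ T ‖B' t ω‖₊ ω) P ξ μ =
      (((1 + 2 * lam * μ ^ (-1 / 2 : ℝ)) / (μ + 2 * lam * √μ + c ^ 2 * ξ ^ 2) : ℝ) : ℂ) := by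
  have hs : 0 < √μ := Real.sqrt_pos.2 hμ
  have hrpow : μ ^ (-1 / 2 : ℝ) = (√μ)⁻¹ := by
    rw [Real.sqrt_eq_rpow, ← Real.rpow_neg hμ.le]; norm_num
  -- The telegraph transform is then taken at `p = √μ`, so that `p²` gives back `μ` in the
  -- denominator.
  have h := hB'.laplace_integral_abs hμ (g := fun x ↦ fourierLaw (T x.toNNReal) P ξ)
    ((hT.continuous_fourierLaw ξ).comp continuous_real_toNNReal)
    (fun x ↦ norm_fourierLaw_le _ _)
  rw [hT.laplace_fourierLaw hc ξ hs, Real.sq_sqrt hμ.le] at h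
  have hval : (√μ)⁻¹ * ((√μ + 2 * lam) / (μ + 2 * lam * √μ + c ^ 2 * ξ ^ 2))
      = (1 + 2 * lam * μ ^ (-1 / 2 : ℝ)) / (μ + 2 * lam * √μ + c ^ 2 * ξ ^ 2) := by
    rw [hrpow, ← mul_div_assoc]
    congr 1
    field_simp
  rw [← hval, Complex.ofReal_mul, Complex.ofReal_inv, ← h, fourierLaplace]
  refine integral_congr_ae (ae_of_all _ fun t ↦ ?_)
  simp only [fourierLaw_telegraphBrownian hT hB' hTB']
  congr 2
  funext ω
  congr 2
  ext
  simp

lemma continuous_fourierLaw_telegraphBrownian (hT : IsTelegraphProcess c lam T P)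
    (hB' : IsBrownianSpeedTwo B' P)
    (hTB' : IndepFun (fun ω t ↦ T t ω) (fun ω t ↦ |B' t ω|) P) (ξ : ℝ) :
    Continuous fun t ↦ fourierLaw (fun ω ↦ T ‖B' t ω‖₊ ω) P ξ := by
  simp_rw [fourierLaw_telegraphBrownian hT hB' hTB']
  have hψ := hT.continuous_fourierLaw ξ
  refine continuous_of_dominated (bound := fun _ ↦ 1) (fun t ↦ ?_)
    (fun t ↦ ae_of_all _ fun ω ↦ norm_fourierLaw_le _ _) (integrable_const _) ?_
  · exact (hψ.measurable.comp (hB'.measurable t).nnnorm).aestronglyMeasurable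
  · filter_upwards [hB'.ae_continuous] with ω hω
    exact hψ.comp hω.nnnorm

end TelegraphBrownian

/-- Both subordinated processes have the same one-dimensional Fourier transforms. -/
lemma fourierLaw_timeChangedBrownian_eq_telegraphBrownian {Ω' : Type*} [MeasurableSpace Ω']
    {P' : Measure Ω'} [IsProbabilityMeasure P'] (hc : 0 < c) (hlam : 0 < lam)
    {B H : ℝ≥0 → Ω → ℝ} (hB : IsBrownianSpeedTwo B P)
    (hH : IsStableSubordinator (1 / 2) H P)
    (hBH : IndepFun (fun ω t ↦ B t ω) (fun ω t ↦ H t ω) P)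
    {T B' : ℝ≥0 → Ω' → ℝ} (hT : IsTelegraphProcess c lam T P')
    (hB' : IsBrownianSpeedTwo B' P')
    (hTB' : IndepFun (fun ω t ↦ T t ω) (fun ω t ↦ |B' t ω|) P') (t : ℝ≥0) (ξ : ℝ) :
    fourierLaw (fun ω ↦ B (c ^ 2 * inverseProcess lam H t ω) ω) P ξ
      = fourierLaw (fun ω ↦ T ‖B' t ω‖₊ ω) P' ξ := by
  have h1 : Continuous fun t : ℝ≥0 ↦
      fourierLaw (fun ω ↦ B (c ^ 2 * inverseProcess lam H t ω) ω) P ξ := by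
    simp_rw [fourierLaw_timeChangedBrownian hB hH hBH]
    exact Complex.continuous_ofReal.comp
      (hH.continuous_integral_exp_inverseProcess lam (by positivity))
  have h2 := continuous_fourierLaw_telegraphBrownian hT hB' hTB' ξ
  -- Continuity in `t` of both sides upgrades equality of the Laplace transforms to equality at each
  -- `t`, not merely at almost every one.
  have h := eq_of_laplace_eq (C := 1)
    (f := fun r ↦ fourierLaw (fun ω ↦ B (c ^ 2 * inverseProcess lam H r.toNNReal ω) ω) P ξ)
    (g := fun r ↦ fourierLaw (fun ω ↦ T ‖B' r.toNNReal ω‖₊ ω) P' ξ)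
    (h1.comp continuous_real_toNNReal).continuousOn
    (h2.comp continuous_real_toNNReal).continuousOn
    (fun r _ ↦ norm_fourierLaw_le _ _) (fun r _ ↦ norm_fourierLaw_le _ _)
    (fun μ hμ ↦ (fourierLaplace_timeChangedBrownian hB hH hBH hlam ξ hμ).trans
      (fourierLaplace_telegraphBrownian hT hB' hTB' hc ξ hμ).symm) t t.coe_nonneg
  simpa only [Real.toNNReal_coe] using h

end Subordinated

end Auxiliary

theorem mainTheorem3
    {Ω Ω' : Type*} [MeasurableSpace Ω] [MeasurableSpace Ω']
    (P : Measure Ω) [IsProbabilityMeasure P] (P' : Measure Ω') [IsProbabilityMeasure P']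
    (c lam : ℝ≥0) (hc : 0 < c) (hlam : 0 < lam)
    -- the left-hand side: a Brownian motion and an independent stable subordinator of order 1/2
    (B H : ℝ≥0 → Ω → ℝ) (hB : IsBrownianSpeedTwo B P)
    (hH : IsStableSubordinator (1 / 2) H P)
    (hBH : IndepFun (fun ω t ↦ B t ω) (fun ω t ↦ H t ω) P)
    -- the right-hand side: a telegraph process and an independent reflecting Brownian motion
    (T B' : ℝ≥0 → Ω' → ℝ) (hT : IsTelegraphProcess c lam T P')
    (hB' : IsBrownianSpeedTwo B' P')
    (hTB' : IndepFun (fun ω t ↦ T t ω) (fun ω t ↦ |B' t ω|) P') :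
    -- equality of the one-dimensional laws
    (∀ t : ℝ≥0, 0 < t →
      IdentDistrib (fun ω ↦ B (c ^ 2 * inverseProcess lam H t ω) ω)
        (fun ω ↦ T ‖B' t ω‖₊ ω) P P') ∧
    -- the characteristic function of the telegraph process; `D` is either square root of
    -- `lam² - c² ξ²`, and for `D = 0` the value is the limit of the general expression
    (∀ (t : ℝ≥0) (ξ : ℝ) (D : ℂ), D ^ 2 = (lam : ℂ) ^ 2 - (c : ℂ) ^ 2 * (ξ : ℂ) ^ 2 →
      (D ≠ 0 → fourierLaw (T t) P' ξ =
        1 / 2 * ((1 + lam / D) * Complex.exp (-lam * t + t * D)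
          + (1 - lam / D) * Complex.exp (-lam * t - t * D))) ∧
      (D = 0 → fourierLaw (T t) P' ξ = Complex.exp (-lam * t) * (1 + lam * t))) ∧
    -- the common Fourier–Laplace transform; its value is never zero, so both integrals converge
    (∀ ξ μ : ℝ, 0 < μ →
      fourierLaplace (fun t ω ↦ B (c ^ 2 * inverseProcess lam H t ω) ω) P ξ μ =
        (((1 + 2 * lam * μ ^ (-1 / 2 : ℝ)) / (μ + 2 * lam * √μ + c ^ 2 * ξ ^ 2) : ℝ) : ℂ) ∧
      fourierLaplace (fun t ω ↦ T ‖B' t ω‖₊ ω) P' ξ μ =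
        (((1 + 2 * lam * μ ^ (-1 / 2 : ℝ)) / (μ + 2 * lam * √μ + c ^ 2 * ξ ^ 2) : ℝ) : ℂ)) := by
  refine ⟨fun t _ ↦ identDistrib_of_fourierLaw_eq
      (aemeasurable_timeChangedBrownian hB hH c lam t) (aemeasurable_telegraphBrownian hT hB' t)
      (fourierLaw_timeChangedBrownian_eq_telegraphBrownian hc hlam hB hH hBH hT hB' hTB' t),
    fun t ξ D hD ↦ ⟨fun hD0 ↦ hT.fourierLaw_eq hc t ξ hD hD0, fun hD0 ↦ ?_⟩,
    fun ξ μ hμ ↦ ⟨fourierLaplace_timeChangedBrownian hB hH hBH hlam ξ hμ,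
      fourierLaplace_telegraphBrownian hT hB' hTB' hc ξ hμ⟩⟩
  refine hT.fourierLaw_eq_of_eq_zero hc t ξ ?_
  rw [← hD, hD0]
  simp
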